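/- Consider a free-space optical system in which a source $S$ communicates with a destination $D$ only through $N$ relays $R_1,\dots,R_N$. Let $\eta,T_b,P_t,N_0,\gamma_{th}>0$ be the responsivity, slot duration, total transmit power, noise density and threshold SNR, and let $P_M=\eta T_bP_t/\sqrt{N_0\gamma_{th}}$ be the power margin. Each link $AB\in\{SR_m,R_mD\}$ has a power fraction $\rho_{AB}>0$, a path loss $\bar h_{AB}>0$ and a channel gain $h_{AB}=\bar h_{AB}\tilde h_{AB}$. The $2N$ turbulence factors $\tilde h_{AB}$ are independent, and $\tilde h_{AB}$ has the Gamma-Gamma density with parameters $\alpha_{AB},\beta_{AB}>0$, $$f(x)=\frac{2(\alpha\beta)^{(\alpha+\beta)/2}}{\Gamma(\alpha)\Gamma(\beta)}\,x^{\frac{\alpha+\beta}2-1}K_{\alpha-\beta}\big(2\sqrt{\alpha\beta x}\big),\qquad x>0,$$ with $K_\nu$ the modified Bessel function of the second kind. Relay $R_m$ decodes, and then forwards, if and only if its SNR $\eta^2T_b^2P_t^2\rho_{SR_m}^2h_{SR_m}^2/N_0$ exceeds $\gamma_{th}$; let $\mathbf D$ be the random set of (the indices of) the relays that decode. In all-active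 relaying an outage occurs if $\mathbf D=\emptyset$ or the SNR at the destination, $\eta^2T_b^2P_t^2\big(\sum_{m\in\mathbf D}\rho_{R_mD}h_{R_mD}\big)^2/N_0$, is below $\gamma_{th}$; let $P_{out}$ be its probability. For $S\subseteq\{1,\dots,N\}$ let $F_S$ be the cdf of $h_S=\sum_{m\in S}\rho_{R_mD}h_{R_mD}$, let $\mathcal M_{R_mD}(s)=\mathbb E[e^{s h_{R_mD}}]$, and put $$Q_m=\frac{1}{\Gamma(\alpha_{SR_m})\Gamma(\beta_{SR_m})}\,G^{2,1}_{1,3}\!\left[\frac{\alpha_{SR_m}\beta_{SR_m}/\bar h_{SR_m}}{\rho_{SR_m}P_M}\,\middle|\,\begin{matrix}1\\ \alpha_{SR_m},\beta_{SR_m},0\end{matrix}\right],$$ with $G$ Meijer's $G$-function. For $A,x>0$ and integers $K,L\ge0$ let $$\hat F_S^{A,K,L}(x)=\frac{2^{-K}e^{A/2}}{x}\sum_{k=0}^{K}\binom Kk\left(\frac12\,\mathrm{Re}\,\Phi_S\!\Big(\frac{A}{2x}\Big)+\sum_{l=1}^{L+k}(-1)^l\,\mathrm{Re}\,\Phi_S\!\Big(\frac{A+2\pi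 jl}{2x}\Big)\right),\qquad \Phi_S(s)=\frac1s\prod_{m\in S}\mathcal M_{R_mD}(-\rho_{R_mD}s),$$ where $j$ is the imaginary unit. **Theorem 2.** For every $S\subseteq\{1,\dots,N\}$, $\Pr\{\mathbf D=S\}=\prod_{m\in S}(1-Q_m)\prod_{m\notin S}Q_m$, and $$P_{out}=\sum_{S\subseteq\{1,\dots,N\}}\;\prod_{m\in S}(1-Q_m)\prod_{m\notin S}Q_m\;F_S\!\Big(\frac1{P_M}\Big).$$ Here $F_S$ is evaluated by the inversion formula $\hat F_S^{A,K,L}$ in the following sense: for all $S$ and all $x,A>0$, $\hat F_S^{A,K,L}(x)$ converges as $K+L\to\infty$, to a limit that exceeds $F_S(x)$ by at least $0$ and at most $e^{-A}/(1-e^{-A})$. Consequently, for every $A>0$, the right-hand side of the formula for $P_{out}$, with $\hat F_S^{A,K,L}(1/P_M)$ in place of $F_S(1/P_M)$, converges as $K+L\to\infty$, to a limit that exceeds $P_{out}$ by at least $0$ and at most $e^{-A}/(1-e^{-A})$. -/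

import Mathlib

open MeasureTheory ProbabilityTheory Filter Topology

noncomputable section

namespace FSO

/-! ### Special functions -/

/-- The modified Bessel function of the second kind of real order `ν`, at `z > 0`, through the
integral `K_ν(z) = (1/2) (z/2)^ν ∫_0^∞ t^(-ν-1) exp(-t - z²/(4t)) dt`. -/
def besselK (ν z : ℝ) : ℝ :=
  1 / 2 * (z / 2) ^ ν * ∫ t in Set.Ioi (0 : ℝ), t ^ (-ν - 1) * Real.exp (-t - z ^ 2 / (4 * t))

/-- The Mellin-Barnes integrand of Meijer's `G^{m,n}_{p,q}[z | a ; b]`. -/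
def meijerGIntegrand (m n : ℕ) {p q : ℕ} (a : Fin p → ℂ) (b : Fin q → ℂ) (z s : ℂ) : ℂ :=
  (∏ j : Fin q, if (j : ℕ) < m then Complex.Gamma (b j - s) else (Complex.Gamma (1 - b j + s))⁻¹) *
  (∏ j : Fin p, if (j : ℕ) < n then Complex.Gamma (1 - a j + s) else (Complex.Gamma (a j - s))⁻¹) *
  z ^ s

/-- The vertical line `Re s = c` separates the poles of the `Γ(b_j - s)`, `j ≤ m` (they lie to its
right), from the poles of the `Γ(1 - a_j + s)`, `j ≤ n` (they lie to its left). -/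
def SeparatesPoles (m n : ℕ) {p q : ℕ} (a : Fin p → ℂ) (b : Fin q → ℂ) (c : ℝ) : Prop :=
  (∀ j : Fin q, (j : ℕ) < m → c < (b j).re) ∧ (∀ j : Fin p, (j : ℕ) < n → (a j).re - 1 < c)

open Classical in
/-- Meijer's `G`-function `G^{m,n}_{p,q}[z | a ; b] = (2πi)⁻¹ ∫_L (integrand) ds`, where `L` is a
vertical line, traversed upwards, that separates the two families of poles (any such line).
The definition is meant for parameters for which such a line exists. -/
def meijerG (m n : ℕ) {p q : ℕ} (a : Fin p → ℂ) (b : Fin q → ℂ) (z : ℂ) : ℂ :=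
  if h : ∃ c : ℝ, SeparatesPoles m n a b c then
    (2 * Real.pi : ℂ)⁻¹ * ∫ t : ℝ, meijerGIntegrand m n a b z ((h.choose : ℂ) + t * Complex.I)
  else 0

/-! ### Gamma-Gamma fading -/

/-- The density of the Gamma-Gamma distribution (with unit mean) with parameters `α, β`. -/
def gammaGammaPDF (α β x : ℝ) : ℝ :=
  if 0 < x then
    2 * (α * β) ^ ((α + β) / 2) / (Real.Gamma α * Real.Gamma β) * x ^ ((α + β) / 2 - 1) *
      besselK (α - β) (2 * Real.sqrt (α * β * x))
  else 0

/-- The Gamma-Gamma distribution with parameters `α, β`. -/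
def gammaGamma (α β : ℝ) : Measure ℝ :=
  volume.withDensity fun x => ENNReal.ofReal (gammaGammaPDF α β x)

/-! ### The relaying system -/

/-- The deterministic parameters of one optical link: the Gamma-Gamma parameters `α, β` of its
turbulence, its path loss coefficient, and the fraction `ρ` of the total power allocated to it. -/
structure Link where
  α : ℝ
  β : ℝ
  pathLoss : ℝ
  ρ : ℝ
  α_pos : 0 < α
  β_pos : 0 < β
  pathLoss_pos : 0 < pathLoss
  ρ_pos : 0 < ρ

/-- The channel gain of a link (path loss times turbulence) when the turbulence factor is `y`. -/
def Link.gain (l : Link) (y : ℝ) : ℝ := l.pathLoss * y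

/-- The moment generating function `s ↦ E[exp (s h)]` of the channel gain `h` of a link. -/
def Link.mgf (l : Link) (s : ℂ) : ℂ := complexMGF l.gain (gammaGamma l.α l.β) s

/-- A relay-assisted system with `N` relays: photodetector responsivity `η`, slot duration `Tb`,
total transmit power `Pt`, noise density `N0`, threshold SNR `γth`, the source-relay links `SR` and
the relay-destination links `RD`. -/
structure RelaySystem (N : ℕ) where
  η : ℝ
  Tb : ℝ
  Pt : ℝ
  N0 : ℝ
  γth : ℝ
  η_pos : 0 < η
  Tb_pos : 0 < Tb
  Pt_pos : 0 < Pt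
  N0_pos : 0 < N0
  γth_pos : 0 < γth
  SR : Fin N → Link
  RD : Fin N → Link

namespace RelaySystem

variable {N : ℕ} (sys : RelaySystem N)

/-- The power margin `P_M = η T_b P_t / √(N_0 γ_th)`. -/
def powerMargin : ℝ := sys.η * sys.Tb * sys.Pt / Real.sqrt (sys.N0 * sys.γth)

/-- The instantaneous SNR of a receiver at which the power-weighted channel gain is `g`. -/
def snr (g : ℝ) : ℝ := sys.η ^ 2 * sys.Tb ^ 2 * sys.Pt ^ 2 * g ^ 2 / sys.N0

/-- The power-weighted sum `h_S = ∑_{m ∈ S} ρ_{R_m D} h_{R_m D}` of the relay-destination gains,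
when the turbulence factors of these links are `y`. -/
def weightedGain (S : Finset (Fin N)) (y : Fin N → ℝ) : ℝ :=
  ∑ m ∈ S, (sys.RD m).ρ * (sys.RD m).gain (y m)

open Classical in
/-- The decoding set, i.e. the set of relays whose received SNR exceeds the threshold, when the
turbulence factors of the source-relay links are `y`. -/
def decodingSet (y : Fin N → ℝ) : Finset (Fin N) :=
  {m | sys.γth < sys.snr ((sys.SR m).ρ * (sys.SR m).gain (y m))}

/-- The outage condition of all-active decode-and-forward relaying, when the turbulence factors of
the source-relay and relay-destination links are `x` and `y`. -/
def Outage (x y : Fin N → ℝ) : Prop :=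
  sys.decodingSet x = ∅ ∨ sys.snr (sys.weightedGain (sys.decodingSet x) y) < sys.γth

/-- The expression `(Γ(α) Γ(β))⁻¹ G^{2,1}_{1,3}[(α β / h̄) / (ρ P_M) | 1 ; α, β, 0]` for a link. -/
def linkOutage (l : Link) : ℂ :=
  1 / (Complex.Gamma l.α * Complex.Gamma l.β) *
    meijerG 2 1 ![1] ![(l.α : ℂ), (l.β : ℂ), 0]
      (((l.α * l.β / l.pathLoss) / (l.ρ * sys.powerMargin) : ℝ) : ℂ)

/-- The product of decoding and non-decoding probabilities that belongs to the decoding set `S`. -/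
def decodingWeight (S : Finset (Fin N)) : ℂ :=
  (∏ m ∈ S, (1 - sys.linkOutage (sys.SR m))) * ∏ m ∈ Sᶜ, sys.linkOutage (sys.SR m)

/-- The moment generating function of the weighted sum `h_S`, as a product over the links. -/
def sumMGF (S : Finset (Fin N)) (s : ℂ) : ℂ := ∏ m ∈ S, (sys.RD m).mgf ((sys.RD m).ρ * s)

end RelaySystem

/-- The Euler-summation inversion formula with parameters `A, K, L`, which evaluates at `x > 0` the
cdf of a nonnegative random variable with moment generating function `M`. -/
def eulerInversion (M : ℂ → ℂ) (A : ℝ) (K L : ℕ) (x : ℝ) : ℝ :=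
  (2 : ℝ)⁻¹ ^ K * Real.exp (A / 2) / x *
    ∑ k ∈ Finset.range (K + 1), (K.choose k : ℝ) *
      (1 / 2 * (M (-((A : ℂ) / (2 * x))) / ((A : ℂ) / (2 * x))).re +
        ∑ l ∈ Finset.Icc 1 (L + k), (-1 : ℝ) ^ l *
          (M (-(((A : ℂ) + Complex.I * (2 * Real.pi * l)) / (2 * x))) /
            (((A : ℂ) + Complex.I * (2 * Real.pi * l)) / (2 * x))).re)

end FSO

end

/-! The weights and the inversion formula rest on separate arguments.

Weights. A Gamma-Gamma variable is a product of two independent Gamma variables of unit mean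
(`gammaGamma_eq_map`), so its moment of order `-s` is `(αβ)^s Γ(α-s)Γ(β-s) / (Γ(α)Γ(β))`. By Fubini
the Mellin transform of a distribution function at `-s` is that moment divided by `s`
(`mellin_measureReal_Iic`), and Mellin inversion is then exactly the Mellin-Barnes integral of the
`G`-function (`meijerG_eq_gammaGamma_Iic`). Hence `Q_m` is the probability that relay `m` fails to
decode. Independence gives the law of the decoding set, and splitting the outage event along this
set gives the outage formula.

Inversion. Integrated against the law of `h_S`, the partial sums of the series have as integrand at
`u` the factor `exp (A/2 - Au/(2x))` times a partial Fourier sum of the 1-periodic extension of `exp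
(Aτ) / (exp A - 1)` at `τ = (u+x)/(2x)`. The limit (`inversionKernel`) is a step function: `1/(1 -
exp (-A))` up to `x`, then multiplied by `exp (-A)` after each further length `2x`. It exceeds the
indicator of `u ≤ x` by at least `0` and at most `exp (-A)/(1 - exp (-A))`. The Fourier sums are
uniformly bounded and the jumps carry no mass, so dominated convergence applies
(`exists_tendsto_eulerInversion`). Binomial averaging keeps the limit. The error in the outage
probability is a convex combination of the errors for the individual `S`. -/

/-! ### Binomial averages of convergent sequences. -/

open Finset in
/-- Binomial (Euler) averages of a convergent sequence converge to its limit as the order of the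
average plus the starting index tends to infinity. -/
theorem tendsto_binomial_average {s : ℕ → ℝ} {ℓ : ℝ} (hs : Tendsto s atTop (𝓝 ℓ)) :
    Tendsto (fun p : ℕ × ℕ => (2 : ℝ)⁻¹ ^ p.1 *
      ∑ k ∈ range (p.1 + 1), (p.1.choose k : ℝ) * s (p.2 + k)) cofinite (𝓝 ℓ) := by
  have hw : ∀ K : ℕ, (2 : ℝ)⁻¹ ^ K * ∑ k ∈ range (K + 1), (K.choose k : ℝ) = 1 := by
    intro K
    have h : (∑ k ∈ range (K + 1), (K.choose k : ℝ)) = 2 ^ K := by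
      exact_mod_cast Nat.sum_range_choose K
    rw [h, ← mul_pow]; norm_num
  obtain ⟨B, hB⟩ : ∃ B, ∀ n, |s n - ℓ| ≤ B := by
    obtain ⟨B, hB⟩ := (hs.sub_const ℓ).abs.bddAbove_range
    exact ⟨B, fun n => hB ⟨n, rfl⟩⟩
  have hB0 : 0 ≤ B := (abs_nonneg _).trans (hB 0)
  rw [Metric.tendsto_nhds]
  intro ε hε
  obtain ⟨M, hM⟩ := (Metric.tendsto_atTop.1 hs) (ε / 2) (half_pos hε)
  -- The binomial weight of the indices `k < M` is at most `∑ K^k / 2^K`, which vanishes as `K → ∞`.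
  have hsmall : Tendsto (fun K : ℕ => B * ∑ k ∈ range M, (K : ℝ) ^ k / 2 ^ K) atTop (𝓝 0) := by
    have := tendsto_finsetSum (range M) fun k _ =>
      tendsto_pow_const_div_const_pow_of_one_lt k (one_lt_two : (1 : ℝ) < 2)
    simpa using this.const_mul B
  obtain ⟨K₀, hK₀⟩ := eventually_atTop.1 (hsmall.eventually (gt_mem_nhds (half_pos hε)))
  -- Outside this finite rectangle either `K` is large, so the early terms have little weight, or `L
  -- ≥ M`, so there are no early terms. On pairs, `cofinite` is the filter `K + L → ∞`.
  have hfin : (Set.Iio K₀ ×ˢ Set.Iio M : Set (ℕ × ℕ)).Finite :=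
    (Set.finite_Iio _).prod (Set.finite_Iio _)
  filter_upwards [hfin.compl_mem_cofinite] with p hp
  obtain ⟨K, L⟩ := p
  have hp' : K₀ ≤ K ∨ M ≤ L := by
    by_contra! h
    exact hp ⟨h.1, h.2⟩
  have hdiff : (2 : ℝ)⁻¹ ^ K * ∑ k ∈ range (K + 1), (K.choose k : ℝ) * s (L + k) - ℓ =
      (2 : ℝ)⁻¹ ^ K * ∑ k ∈ range (K + 1), (K.choose k : ℝ) * (s (L + k) - ℓ) := by
    simp only [mul_sub, sum_sub_distrib, ← sum_mul]
    rw [← mul_assoc ((2 : ℝ)⁻¹ ^ K) _ ℓ, hw K, one_mul]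
  rw [Real.dist_eq]
  simp only
  rw [hdiff, abs_mul, abs_of_pos (by positivity : (0 : ℝ) < 2⁻¹ ^ K)]
  have hterm : ∀ k ∈ range (K + 1), |(K.choose k : ℝ) * (s (L + k) - ℓ)| ≤
      (K.choose k : ℝ) * (ε / 2) + if L + k < M then (K.choose k : ℝ) * B else 0 := by
    intro k _
    rw [abs_mul, Nat.abs_cast]
    split_ifs with h
    · have := mul_le_mul_of_nonneg_left (hB (L + k)) (Nat.cast_nonneg (α := ℝ) (K.choose k))
      have h2 : 0 ≤ (K.choose k : ℝ) * (ε / 2) := by positivity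
      linarith
    · have := (hM (L + k) (not_lt.1 h)).le
      rw [Real.dist_eq] at this
      simpa using mul_le_mul_of_nonneg_left this (Nat.cast_nonneg (α := ℝ) (K.choose k))
  have hsum : (2 : ℝ)⁻¹ ^ K * |∑ k ∈ range (K + 1), (K.choose k : ℝ) * (s (L + k) - ℓ)| ≤
      ε / 2 + (2 : ℝ)⁻¹ ^ K *
        ∑ k ∈ range (K + 1), if L + k < M then (K.choose k : ℝ) * B else 0 := by
    calc _ ≤ (2 : ℝ)⁻¹ ^ K * ∑ k ∈ range (K + 1), ((K.choose k : ℝ) * (ε / 2) +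
          if L + k < M then (K.choose k : ℝ) * B else 0) := by
          gcongr
          exact (abs_sum_le_sum_abs _ _).trans (sum_le_sum hterm)
      _ = _ := by
          rw [sum_add_distrib, ← sum_mul, mul_add, ← mul_assoc, hw K, one_mul]
  have hrest : (2 : ℝ)⁻¹ ^ K * ∑ k ∈ range (K + 1),
      (if L + k < M then (K.choose k : ℝ) * B else 0) < ε / 2 := by
    rcases hp' with h | h
    · refine lt_of_le_of_lt ?_ (hK₀ K h)
      rw [mul_sum, mul_sum]
      calc _ ≤ ∑ k ∈ range (K + 1), if k < M then B * ((K : ℝ) ^ k / 2 ^ K) else 0 := by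
            refine sum_le_sum fun k _ => ?_
            have hc : (K.choose k : ℝ) ≤ (K : ℝ) ^ k := by exact_mod_cast Nat.choose_le_pow K k
            by_cases h1 : L + k < M
            · rw [if_pos h1, if_pos (by omega : k < M), inv_pow]
              calc _ = B * ((K.choose k : ℝ) / 2 ^ K) := by ring
                _ ≤ _ := by gcongr
            · rw [if_neg h1, mul_zero]
              split_ifs <;> positivity
        _ = ∑ k ∈ (range (K + 1)).filter (· < M), B * ((K : ℝ) ^ k / 2 ^ K) := by
            rw [sum_filter]
        _ ≤ _ := by
            refine sum_le_sum_of_subset_of_nonneg ?_ fun _ _ _ => by positivity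
            intro k hk
            simpa using (mem_filter.1 hk).2
    · rw [sum_eq_zero, mul_zero]
      · exact half_pos hε
      · intro k _
        rw [if_neg (by omega)]
  linarith

/-! ### Fourier series of the exponential: uniform bounds and pointwise convergence. -/

/-- The partial sums of `∑ sin (l φ) / l` are bounded, uniformly in `φ`. -/
theorem abs_sum_sin_div_le (φ : ℝ) (n : ℕ) :
    |∑ l ∈ Finset.range (n + 1), Real.sin (l * φ) / l| ≤ 2 + Real.pi := by
  rcases Nat.eq_zero_or_pos n with rfl | hn
  · simp; positivity
  have hn' : (0 : ℝ) < n := by exact_mod_cast hn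
  -- Comparison with the Abel mean at radius `r`, which is the imaginary part of `-log (1 - z)`.
  -- With `1 - r = 1/(n+1)`, damping the first `n` terms and adding the tail each cost at most `1`.
  set r : ℝ := 1 - 1 / (n + 1) with hr
  have hr0 : 0 < r := by
    rw [hr, sub_pos, div_lt_one (by positivity)]; linarith
  have hr1 : r < 1 := by
    rw [hr]; simp; positivity
  have hr1' : 1 - r = 1 / (n + 1) := by rw [hr]; ring
  set z : ℂ := r * Complex.exp (φ * Complex.I) with hz
  have hznorm : ‖z‖ = r := by
    rw [hz, norm_mul, Complex.norm_exp_ofReal_mul_I, mul_one, Complex.norm_real,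
      Real.norm_of_nonneg hr0.le]
  have hs := Complex.hasSum_taylorSeries_neg_log (z := z) (by rw [hznorm]; exact hr1)
  have hterm : ∀ l : ℕ, (z ^ l / l).im = r ^ l * (Real.sin (l * φ) / l) := by
    intro l
    rw [hz, mul_pow, ← Complex.exp_nat_mul, ← mul_assoc]
    have : (r : ℂ) ^ l * Complex.exp (l * φ * Complex.I) / l =
        ((r ^ l / l : ℝ) : ℂ) * Complex.exp (((l * φ : ℝ) : ℂ) * Complex.I) := by
      push_cast; ring
    rw [this, Complex.im_ofReal_mul, Complex.exp_ofReal_mul_I_im]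
    ring
  have him := Complex.hasSum_im hs
  simp only [hterm] at him
  -- As `‖z‖ < 1`, the point `1 - z` lies in the right half-plane.
  have hlog : |(-Complex.log (1 - z)).im| ≤ Real.pi / 2 := by
    rw [Complex.neg_im, abs_neg, Complex.log_im, Complex.abs_arg_le_pi_div_two_iff]
    have := (Complex.re_le_norm z).trans_eq hznorm
    simp only [Complex.sub_re, Complex.one_re]
    linarith
  have hgeo := (hasSum_geometric_of_lt_one hr0.le hr1)
  have htail : |(-Complex.log (1 - z)).im -
      ∑ l ∈ Finset.range (n + 1), r ^ l * (Real.sin (l * φ) / l)| ≤ 1 := by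
    have h1 := (hasSum_nat_add_iff' (n + 1)).2 him
    have h2 : HasSum (fun l : ℕ => (1 / (n + 1) : ℝ) * r ^ l) 1 := by
      have := hgeo.mul_left (1 / (n + 1) : ℝ)
      rwa [hr1', mul_inv_cancel₀ (by positivity)] at this
    have hb : ∀ l : ℕ, ‖r ^ (l + (n + 1)) * (Real.sin ((l + (n + 1) : ℕ) * φ) / (l + (n + 1) : ℕ))‖
        ≤ 1 / (n + 1) * r ^ l := by
      intro l
      rw [norm_mul, norm_div, Real.norm_of_nonneg (by positivity : 0 ≤ r ^ (l + (n + 1))),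
        Real.norm_of_nonneg (Nat.cast_nonneg (α := ℝ) _), mul_comm]
      have h3 : r ^ (l + (n + 1)) ≤ r ^ l := pow_le_pow_of_le_one hr0.le hr1.le (by omega)
      have h4 : ‖Real.sin ((l + (n + 1) : ℕ) * φ)‖ ≤ 1 := Real.abs_sin_le_one _
      have h5 : (n : ℝ) + 1 ≤ ((l + (n + 1) : ℕ) : ℝ) := by
        push_cast; linarith [Nat.cast_nonneg (α := ℝ) l]
      gcongr
    have := h1.norm_le_of_bounded h2 hb
    rwa [Real.norm_eq_abs] at this
  have hhead : |∑ l ∈ Finset.range (n + 1), Real.sin (l * φ) / l -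
      ∑ l ∈ Finset.range (n + 1), r ^ l * (Real.sin (l * φ) / l)| ≤ 1 := by
    rw [← Finset.sum_sub_distrib]
    refine (Finset.abs_sum_le_sum_abs _ _).trans ?_
    calc _ ≤ ∑ l ∈ Finset.range (n + 1), (1 / (n + 1) : ℝ) := by
          refine Finset.sum_le_sum fun l _ => ?_
          rcases Nat.eq_zero_or_pos l with rfl | hl
          · simp; positivity
          have hl' : (0 : ℝ) < l := by exact_mod_cast hl
          have hber : 1 - r ^ l ≤ l * (1 - r) := by
            have := one_add_mul_le_pow (a := r - 1) (by linarith) l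
            rw [add_sub_cancel] at this
            linarith
          have hle : r ^ l ≤ 1 := pow_le_one₀ hr0.le hr1.le
          have h4 : |Real.sin (l * φ)| ≤ 1 := Real.abs_sin_le_one _
          rw [show Real.sin (l * φ) / l - r ^ l * (Real.sin (l * φ) / l) =
            (1 - r ^ l) / l * Real.sin (l * φ) by ring, abs_mul,
            abs_of_nonneg (div_nonneg (by linarith) hl'.le)]
          calc _ ≤ (1 - r ^ l) / l * 1 := by
                gcongr
            _ ≤ 1 - r := by rw [mul_one, div_le_iff₀ hl']; linarith
            _ = _ := hr1'
      _ = 1 := by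
          rw [Finset.sum_const, Finset.card_range, nsmul_eq_mul]
          push_cast
          field_simp
  have hpi := Real.pi_pos
  rw [abs_le] at *
  constructor <;> linarith [hhead.1, hhead.2, htail.1, htail.2, hlog.1, hlog.2]

/-- The symmetric partial sums of the Fourier series of `exp (A τ) / (exp A - 1)` on `(0, 1)`. -/
noncomputable def expFourierSum (A : ℝ) (n : ℕ) (τ : ℝ) : ℝ :=
  1 / A + 2 * ∑ l ∈ Finset.Icc 1 n,
    (Complex.exp (-(2 * Real.pi * l * τ : ℝ) * Complex.I) / (A + 2 * Real.pi * l * Complex.I)).re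

theorem exp_div_re_eq {A : ℝ} (hA : 0 < A) (l : ℕ) (τ : ℝ) :
    (Complex.exp (-(2 * Real.pi * l * τ : ℝ) * Complex.I) /
      (A + 2 * Real.pi * l * Complex.I)).re =
    (A * Real.cos (2 * Real.pi * l * τ) - 2 * Real.pi * l * Real.sin (2 * Real.pi * l * τ)) /
      (A ^ 2 + (2 * Real.pi * l) ^ 2) := by
  have h1 : (A + 2 * Real.pi * l * Complex.I : ℂ) = ⟨A, 2 * Real.pi * l⟩ := by
    apply Complex.ext <;> simp
  have h2 : Complex.exp (-(2 * Real.pi * l * τ : ℝ) * Complex.I) =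
      ⟨Real.cos (2 * Real.pi * l * τ), -Real.sin (2 * Real.pi * l * τ)⟩ := by
    rw [← Complex.ofReal_neg]
    apply Complex.ext
    · rw [Complex.exp_ofReal_mul_I_re, Real.cos_neg]
    · rw [Complex.exp_ofReal_mul_I_im, Real.sin_neg]
  rw [h1, h2, Complex.div_re, Complex.normSq_mk]
  field_simp
  ring

/-- The partial sums `expFourierSum A n` are uniformly bounded. -/
theorem exists_abs_expFourierSum_le {A : ℝ} (hA : 0 < A) :
    ∃ C, ∀ n τ, |expFourierSum A n τ| ≤ C := by
  have hpi := Real.pi_pos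
  have hpi3 := Real.pi_gt_three
  set S : ℝ := ∑' l : ℕ, 1 / (l : ℝ) ^ 2 with hS
  have hsum : Summable fun l : ℕ => 1 / (l : ℝ) ^ 2 := Real.summable_one_div_nat_pow.2 (by norm_num)
  refine ⟨1 / A + 2 * ((A + A ^ 2) * S + (2 + Real.pi)), fun n τ => ?_⟩
  have hsin : |∑ l ∈ Finset.Icc 1 n, Real.sin (l * (2 * Real.pi * τ)) / l| ≤ 2 + Real.pi := by
    have := abs_sum_sin_div_le (2 * Real.pi * τ) n
    rwa [Finset.range_eq_Ico, Finset.sum_eq_sum_Ico_succ_bot (by omega), Nat.cast_zero, div_zero,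
      zero_add, zero_add] at this
  -- Up to a summable `O(1/l²)` error, each term is `-sin (2πlτ) / (2πl)`, whose partial sums are
  -- already bounded.
  have hterm : ∀ l ∈ Finset.Icc 1 n,
      |(Complex.exp (-(2 * Real.pi * l * τ : ℝ) * Complex.I) /
        (A + 2 * Real.pi * l * Complex.I)).re +
        (2 * Real.pi)⁻¹ * (Real.sin (l * (2 * Real.pi * τ)) / l)| ≤ (A + A ^ 2) * (1 / (l : ℝ) ^ 2) := by
    intro l hl
    have hl1 : (1 : ℝ) ≤ l := by exact_mod_cast (Finset.mem_Icc.1 hl).1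
    have hl0 : (0 : ℝ) < l := by linarith
    rw [exp_div_re_eq hA, show (l : ℝ) * (2 * Real.pi * τ) = 2 * Real.pi * l * τ by ring]
    set c := Real.cos (2 * Real.pi * l * τ)
    set d := Real.sin (2 * Real.pi * l * τ)
    have hc : |c| ≤ 1 := Real.abs_cos_le_one _
    have hd : |d| ≤ 1 := Real.abs_sin_le_one _
    set q := 2 * Real.pi * l with hq
    have hql : (l : ℝ) ≤ q := by rw [hq]; nlinarith
    have hq1 : 1 ≤ q := by linarith
    rw [show (A * c - q * d) / (A ^ 2 + q ^ 2) + (2 * Real.pi)⁻¹ * (d / l) =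
      (A * c + A ^ 2 * d / q) / (A ^ 2 + q ^ 2) by rw [hq]; field_simp; ring]
    rw [abs_div, abs_of_pos (by positivity : 0 < A ^ 2 + q ^ 2), mul_one_div]
    have hnum : |A * c + A ^ 2 * d / q| ≤ A + A ^ 2 := by
      refine (abs_add_le _ _).trans ?_
      rw [abs_mul, abs_div, abs_mul, abs_of_pos hA, abs_of_pos (by positivity : 0 < A ^ 2),
        abs_of_pos (by linarith : 0 < q)]
      have h1 : A * |c| ≤ A := by nlinarith
      have h2 : A ^ 2 * |d| / q ≤ A ^ 2 := by
        rw [div_le_iff₀ (by linarith)]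
        have : 0 < A ^ 2 := by positivity
        nlinarith
      linarith
    gcongr
    nlinarith [sq_nonneg A]
  have hkey : |∑ l ∈ Finset.Icc 1 n, ((Complex.exp (-(2 * Real.pi * l * τ : ℝ) * Complex.I) /
        (A + 2 * Real.pi * l * Complex.I)).re +
        (2 * Real.pi)⁻¹ * (Real.sin (l * (2 * Real.pi * τ)) / l))| ≤ (A + A ^ 2) * S := by
    refine (Finset.abs_sum_le_sum_abs _ _).trans ((Finset.sum_le_sum hterm).trans ?_)
    rw [← Finset.mul_sum]
    gcongr
    exact hsum.sum_le_tsum _ fun _ _ => by positivity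
  rw [Finset.sum_add_distrib, ← Finset.mul_sum] at hkey
  have hsin2 : |(2 * Real.pi)⁻¹ * ∑ l ∈ Finset.Icc 1 n, Real.sin (l * (2 * Real.pi * τ)) / l| ≤
      2 + Real.pi := by
    rw [abs_mul, abs_of_pos (by positivity : 0 < (2 * Real.pi)⁻¹)]
    have : (2 * Real.pi)⁻¹ ≤ 1 := inv_le_one_of_one_le₀ (by linarith)
    calc _ ≤ 1 * (2 + Real.pi) := by gcongr
      _ = _ := one_mul _
  rw [expFourierSum]
  have hA' : 0 < 1 / A := by positivity
  rw [abs_le] at *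
  constructor <;> linarith [hkey.1, hkey.2, hsin2.1, hsin2.2]

/-- The Riemann-Lebesgue lemma for the Fourier coefficients of a function on `[0, 1]`. -/
theorem tendsto_integral_exp_mul_int (g : ℝ → ℂ) {k : ℕ → ℤ} (hk : Tendsto (fun n => |k n|) atTop atTop) :
    Tendsto (fun n => ∫ t in (0 : ℝ)..1, Complex.exp (2 * Real.pi * k n * t * Complex.I) * g t)
      atTop (𝓝 0) := by
  have h := Real.tendsto_integral_exp_smul_cocompact ((Set.Ioc (0 : ℝ) 1).indicator g)
  -- The Fourier transform carries the character with a minus sign, so frequency `-k n` yields the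
  -- factor `exp (2πi (k n) t)`.
  have hk' : Tendsto (fun n => -(k n : ℝ)) atTop (cocompact ℝ) := by
    rw [← Metric.cobounded_eq_cocompact, ← tendsto_norm_atTop_iff_cobounded]
    have : Tendsto (fun n => ((|k n| : ℤ) : ℝ)) atTop atTop := tendsto_intCast_atTop_atTop.comp hk
    refine this.congr fun n => ?_
    rw [norm_neg, Real.norm_eq_abs, Int.cast_abs]
  refine (h.comp hk').congr fun n => ?_
  rw [Function.comp_apply, intervalIntegral.integral_of_le zero_le_one,
    ← integral_indicator measurableSet_Ioc]
  congr 1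
  ext t
  by_cases ht : t ∈ Set.Ioc (0 : ℝ) 1
  · rw [Set.indicator_of_mem ht, Set.indicator_of_mem ht, Circle.smul_def, Real.fourierChar_apply,
      smul_eq_mul]
    congr 2
    push_cast
    ring
  · rw [Set.indicator_of_notMem ht, Set.indicator_of_notMem ht, smul_zero]

theorem integral_exp_two_pi_mul_int_mul_I (k : ℤ) :
    ∫ t in (0 : ℝ)..1, Complex.exp (2 * Real.pi * k * t * Complex.I) = if k = 0 then 1 else 0 := by
  split_ifs with hk
  · simp [hk]
  · have hc : (2 * Real.pi * k * Complex.I : ℂ) ≠ 0 := by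
      simp [Real.pi_ne_zero, hk]
    have := integral_exp_mul_complex (a := 0) (b := 1) hc
    rw [Complex.ofReal_one, mul_one, Complex.ofReal_zero, mul_zero, Complex.exp_zero,
      show (2 * Real.pi * k * Complex.I : ℂ) = k * (2 * Real.pi * Complex.I) by ring,
      Complex.exp_int_mul_two_pi_mul_I, sub_self, zero_div] at this
    rw [← this]
    congr 1; ext t; congr 1; ring

theorem integral_exp_two_pi_mul_int_mul_I_mul_exp {A : ℝ} (hA : 0 < A) (k : ℤ) :
    ∫ t in (0 : ℝ)..1, Complex.exp (2 * Real.pi * k * t * Complex.I) * Complex.exp (A * t) =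
      (Complex.exp A - 1) / (A + 2 * Real.pi * k * Complex.I) := by
  have hc : (A + 2 * Real.pi * k * Complex.I : ℂ) ≠ 0 := by
    intro h
    have := congrArg Complex.re h
    simp at this
    exact hA.ne' this
  have := integral_exp_mul_complex (a := 0) (b := 1) hc
  rw [Complex.ofReal_one, mul_one, Complex.ofReal_zero, mul_zero, Complex.exp_zero,
    show (A + 2 * Real.pi * k * Complex.I : ℂ) = A + k * (2 * Real.pi * Complex.I) by ring,
    Complex.exp_add, Complex.exp_int_mul_two_pi_mul_I, mul_one] at this
  rw [show (A + 2 * Real.pi * k * Complex.I : ℂ) = A + k * (2 * Real.pi * Complex.I) by ring,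
    ← this]
  congr 1; ext t; rw [← Complex.exp_add]; congr 1; ring

/-- Pointwise convergence of the Fourier series of `exp (A τ)` inside `(0, 1)`. -/
theorem tendsto_expFourierSum {A : ℝ} (hA : 0 < A) {τ : ℝ} (hτ : τ ∈ Set.Ioo (0 : ℝ) 1) :
    Tendsto (fun n => expFourierSum A n τ) atTop (𝓝 (Real.exp (A * τ) / (Real.exp A - 1))) := by
  set f : ℝ → ℂ := fun t => Complex.exp (A * t) with hf
  set e : ℝ → ℂ := fun t => Complex.exp (2 * Real.pi * t * Complex.I) with he
  have hfd : Differentiable ℝ f := by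
    intro t; rw [hf]; fun_prop
  have hed : Differentiable ℝ e := by
    intro t; rw [he]; fun_prop
  have hdc : ∀ {h : ℝ → ℂ}, Differentiable ℝ h → Continuous (dslope h τ) := by
    intro h hh
    rw [continuous_iff_continuousAt]
    intro t
    rcases eq_or_ne t τ with rfl | ht
    · exact continuousAt_dslope_same.2 (hh _)
    · exact (continuousAt_dslope_of_ne ht).2 (hh.continuous.continuousAt)
  have hederiv : HasDerivAt e (2 * Real.pi * Complex.I * e τ) τ := by
    have h1 : HasDerivAt (fun t : ℝ => (2 * Real.pi * t * Complex.I : ℂ))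
        (2 * Real.pi * Complex.I) τ := by
      have := ((hasDerivAt_id τ).ofReal_comp.const_mul (2 * Real.pi : ℂ)).mul_const Complex.I
      simpa using this
    have := h1.cexp
    rwa [mul_comm (Complex.exp _)] at this
  -- Since `τ` is interior, no other point of `[0, 1]` differs from `τ` by an integer. At `τ` itself
  -- the derivative of `e` is nonzero.
  have hne : ∀ t ∈ Set.Icc (0 : ℝ) 1, dslope e τ t ≠ 0 := by
    intro t ht
    rcases eq_or_ne t τ with rfl | htτ
    · rw [dslope_same, hederiv.deriv]
      simp [he, Real.pi_ne_zero]
    · rw [dslope_of_ne _ htτ, slope_def_module, smul_ne_zero_iff]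
      refine ⟨inv_ne_zero (sub_ne_zero.2 htτ), sub_ne_zero.2 fun h => htτ ?_⟩
      rw [he, Complex.exp_eq_exp_iff_exists_int] at h
      obtain ⟨n, hn⟩ := h
      have hn' : t = τ + n := by
        have h2 : (2 * Real.pi * Complex.I : ℂ) ≠ 0 := by simp [Real.pi_ne_zero]
        have : (t : ℂ) = τ + n := by
          apply mul_left_cancel₀ h2
          linear_combination hn
        exact_mod_cast this
      have hn1 : (n : ℝ) < 1 := by linarith [ht.2, hτ.1]
      have hn2 : (-1 : ℝ) < n := by linarith [ht.1, hτ.2]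
      have : n = 0 := by
        have h3 : n < 1 := by exact_mod_cast hn1
        have h4 : -1 < n := by exact_mod_cast hn2
        omega
      simpa [this] using hn'
  -- The quotient `(f - f τ)/(e - e τ)` with its removable singularity at `τ` filled in. Being
  -- continuous, it has Fourier coefficients that tend to zero.
  set g : ℝ → ℂ := fun t => dslope f τ t / dslope e τ t with hg
  have hgc : ContinuousOn g (Set.uIcc 0 1) := by
    rw [Set.uIcc_of_le zero_le_one]
    exact (hdc hfd).continuousOn.div (hdc hed).continuousOn hne
  have hfg : ∀ t ∈ Set.Icc (0 : ℝ) 1, f t - f τ = (e t - e τ) * g t := by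
    intro t ht
    rcases eq_or_ne t τ with rfl | htτ
    · simp
    have h1 := sub_smul_dslope f τ t
    have h2 := sub_smul_dslope e τ t
    rw [← h1, ← h2, hg]
    have := hne t ht
    simp only [Complex.real_smul]
    field_simp
  set c : ℤ → ℂ := fun k => ∫ t in (0 : ℝ)..1, Complex.exp (2 * Real.pi * k * t * Complex.I) * g t
    with hc
  have hexp : ∀ k : ℤ, Continuous fun t : ℝ => Complex.exp (2 * Real.pi * k * t * Complex.I) := by
    intro k; fun_prop
  have hint : ∀ k : ℤ, IntervalIntegrable
      (fun t : ℝ => Complex.exp (2 * Real.pi * k * t * Complex.I) * g t) volume 0 1 :=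
    fun k => ((hexp k).continuousOn.mul hgc).intervalIntegrable
  -- Multiplication by `e` shifts the frequency by one, so the coefficients of `f - f τ` are twisted
  -- differences of those of `g`.
  have hrec : ∀ k : ℤ, c (k + 1) - e τ * c k =
      (Complex.exp A - 1) / (A + 2 * Real.pi * k * Complex.I) - if k = 0 then f τ else 0 := by
    intro k
    have h1 : c (k + 1) - e τ * c k =
        ∫ t in (0 : ℝ)..1, Complex.exp (2 * Real.pi * k * t * Complex.I) * (f t - f τ) := by
      rw [hc]
      simp only
      rw [← intervalIntegral.integral_const_mul, ← intervalIntegral.integral_sub (hint _)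
        ((hint _).const_mul _)]
      refine intervalIntegral.integral_congr fun t ht => ?_
      rw [Set.uIcc_of_le zero_le_one] at ht
      rw [hfg t ht, he]
      simp only
      have : Complex.exp (2 * Real.pi * ((k + 1 : ℤ) : ℂ) * t * Complex.I) =
          Complex.exp (2 * Real.pi * k * t * Complex.I) * Complex.exp (2 * Real.pi * t * Complex.I) := by
        rw [← Complex.exp_add]; congr 1; push_cast; ring
      rw [this]; ring
    rw [h1]
    simp only [mul_sub]
    rw [intervalIntegral.integral_sub, intervalIntegral.integral_mul_const,
      integral_exp_two_pi_mul_int_mul_I, integral_exp_two_pi_mul_int_mul_I_mul_exp hA]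
    · simp
    · exact ((hexp k).mul hfd.continuous).intervalIntegrable _ _
    · exact ((hexp k).mul continuous_const).intervalIntegrable _ _
  have he0 : e τ ≠ 0 := Complex.exp_ne_zero _
  set E : ℂ := Complex.exp A - 1 with hE
  have hEreal : E = ((Real.exp A - 1 : ℝ) : ℂ) := by rw [hE]; push_cast; rfl
  have hE0 : Real.exp A - 1 ≠ 0 := (sub_pos.2 (Real.one_lt_exp_iff.2 hA)).ne'
  have hezpow : ∀ k : ℤ, e τ ^ k = Complex.exp (2 * Real.pi * k * τ * Complex.I) := by
    intro k
    rw [he]; simp only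
    rw [← Complex.exp_int_mul]; congr 1; ring
  -- Summing `hrec` over `|k| ≤ n` with weights `e τ ^ (-k)` telescopes. The two boundary terms have
  -- unimodular factors and vanish by Riemann-Lebesgue.
  have htel : ∀ n : ℕ, ((Real.exp A - 1) * expFourierSum A n τ - Real.exp (A * τ) : ℝ) =
      e τ * (e τ ^ (-(n + 1) : ℤ) * c (n + 1) - e τ ^ (n : ℤ) * c (-n)) := by
    intro n
    induction n with
    | zero =>
      have h := hrec 0
      simp only [zero_add, Int.cast_zero, mul_zero, zero_mul, add_zero, if_true] at h
      simp only [expFourierSum, Nat.cast_zero, neg_zero, zero_add, zpow_zero, zpow_neg, zpow_one]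
      rw [one_mul, mul_sub, mul_inv_cancel_left₀ he0, h, hf]
      simp [hEreal]
      ring
    | succ n ih =>
      have hpos := hrec (n + 1)
      have hneg := hrec (-(n + 1))
      rw [if_neg (by omega)] at hpos hneg
      have hstep : (((Real.exp A - 1) * expFourierSum A (n + 1) τ - Real.exp (A * τ) : ℝ) : ℂ) =
          ((Real.exp A - 1) * expFourierSum A n τ - Real.exp (A * τ) : ℝ) +
          (e τ ^ (-(n + 1) : ℤ) * (E / (A + 2 * Real.pi * ((n + 1 : ℤ) : ℂ) * Complex.I)) +
           e τ ^ (n + 1 : ℤ) * (E / (A + 2 * Real.pi * ((-(n + 1) : ℤ) : ℂ) * Complex.I))) := by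
        rw [expFourierSum, expFourierSum, Finset.sum_Icc_succ_top (by omega)]
        set w : ℂ := Complex.exp (-(2 * Real.pi * (n + 1 : ℕ) * τ : ℝ) * Complex.I) /
          (A + 2 * Real.pi * (n + 1 : ℕ) * Complex.I) with hw
        have h1 : e τ ^ (-(n + 1) : ℤ) * (E / (A + 2 * Real.pi * ((n + 1 : ℤ) : ℂ) * Complex.I)) =
            E * w := by
          rw [hezpow, hw]; push_cast
          rw [show (2 * Real.pi * (-(n + 1)) * τ * Complex.I : ℂ) =
            -(2 * Real.pi * (n + 1) * τ) * Complex.I by ring]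
          ring
        have h2 : e τ ^ (n + 1 : ℤ) * (E / (A + 2 * Real.pi * ((-(n + 1) : ℤ) : ℂ) * Complex.I)) =
            E * (starRingEnd ℂ) w := by
          rw [hezpow, hw, map_div₀, ← Complex.exp_conj]
          simp only [map_mul, map_add, map_neg, Complex.conj_I, Complex.conj_ofReal, map_natCast,
            map_ofNat]
          push_cast
          rw [show (2 * Real.pi * (n + 1) * τ * Complex.I : ℂ) =
            -(2 * Real.pi * (n + 1) * τ) * -Complex.I by ring,
            show (2 * Real.pi * -(n + 1) * Complex.I : ℂ) = 2 * Real.pi * (n + 1) * -Complex.I by ring]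
          ring
        rw [h1, h2, ← mul_add, Complex.add_conj, hEreal]
        push_cast
        ring
      rw [hstep, ih]
      rw [sub_zero] at hpos hneg
      rw [← hpos, ← hneg, show (-((n : ℤ) + 1) + 1) = -(n : ℤ) by ring]
      push_cast
      simp only [zpow_neg, zpow_add₀ he0, zpow_one]
      have : e τ ^ (n : ℤ) ≠ 0 := zpow_ne_zero _ he0
      field_simp
      ring
  have hunit : ∀ k : ℤ, ‖e τ ^ k‖ = 1 := by
    intro k
    rw [hezpow, show (2 * Real.pi * k * τ * Complex.I : ℂ) = ((2 * Real.pi * k * τ : ℝ) : ℂ) *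
      Complex.I by push_cast; ring, Complex.norm_exp_ofReal_mul_I]
  have hc1 : Tendsto (fun n : ℕ => c (n + 1)) atTop (𝓝 0) := by
    refine tendsto_integral_exp_mul_int g (k := fun n : ℕ => (n : ℤ) + 1) ?_
    refine tendsto_atTop_mono (fun n => ?_) (tendsto_natCast_atTop_atTop (R := ℤ))
    rw [abs_of_nonneg (by positivity)]; omega
  have hc2 : Tendsto (fun n : ℕ => c (-n)) atTop (𝓝 0) := by
    refine tendsto_integral_exp_mul_int g (k := fun n : ℕ => -(n : ℤ)) ?_
    refine tendsto_atTop_mono (fun n => ?_) (tendsto_natCast_atTop_atTop (R := ℤ))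
    rw [abs_neg]; exact le_abs_self _
  have hlim : Tendsto (fun n : ℕ => (Real.exp A - 1) * expFourierSum A n τ - Real.exp (A * τ))
      atTop (𝓝 0) := by
    rw [tendsto_zero_iff_norm_tendsto_zero]
    have hb : Tendsto (fun n : ℕ => ‖c (n + 1)‖ + ‖c (-n)‖) atTop (𝓝 0) := by
      simpa using hc1.norm.add hc2.norm
    refine squeeze_zero (fun _ => norm_nonneg _) (fun n => ?_) hb
    rw [← Complex.norm_real, htel n, norm_mul]
    have := hunit 1
    rw [zpow_one] at this
    rw [this, one_mul]
    refine (norm_sub_le _ _).trans ?_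
    rw [norm_mul, norm_mul, hunit, hunit, one_mul, one_mul]
  have := (hlim.add_const (Real.exp (A * τ))).div_const (Real.exp A - 1)
  rw [zero_add] at this
  refine this.congr fun n => ?_
  field_simp
  ring

theorem expFourierSum_add_nat (A : ℝ) (n : ℕ) (τ : ℝ) (m : ℕ) :
    expFourierSum A n (τ + m) = expFourierSum A n τ := by
  rw [expFourierSum, expFourierSum]
  congr 2
  refine Finset.sum_congr rfl fun l _ => ?_
  congr 2
  rw [Complex.exp_eq_exp_iff_exists_int]
  refine ⟨-(l * m : ℕ), ?_⟩
  push_cast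
  ring

theorem continuous_expFourierSum (A : ℝ) (n : ℕ) : Continuous (expFourierSum A n) := by
  unfold expFourierSum
  fun_prop

/-! ### The inversion kernel and the Euler-summation formula. -/

/-- The value at `x` of the inversion series of the unit mass at `u`. -/
noncomputable def inversionKernel (A x u : ℝ) : ℝ :=
  Real.exp (-A * ⌈(u - x) / (2 * x)⌉₊) / (1 - Real.exp (-A))

theorem tendsto_inversionKernel {A x u : ℝ} (hA : 0 < A) (hx : 0 < x) (hu : 0 ≤ u)
    (hu' : ∀ k : ℕ, u ≠ (2 * k + 1) * x) :
    Tendsto (fun n => Real.exp (A / 2) * Real.exp (-A * u / (2 * x)) *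
      expFourierSum A n ((u + x) / (2 * x))) atTop (𝓝 (inversionKernel A x u)) := by
  set m : ℕ := ⌈(u - x) / (2 * x)⌉₊ with hm
  -- The fractional representative of `(u + x)/(2x)`. The natural-number ceiling truncates at `0`,
  -- so `m = 0` for all `u ≤ x`; then `u ≥ 0` keeps `τ` positive.
  set τ : ℝ := (u - x) / (2 * x) + 1 - m with hτ
  have h2x : 0 < 2 * x := by linarith
  have hτm : (u + x) / (2 * x) = τ + m := by
    rw [hτ]; field_simp; ring
  have hτ0 : 0 < τ := by
    rw [hτ]
    rcases Nat.eq_zero_or_pos m with h0 | h0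
    · rw [h0, Nat.cast_zero]
      have : 0 < (u + x) / (2 * x) := by positivity
      rw [hτm, h0, hτ, h0] at this
      simpa using this
    · obtain ⟨j, hj⟩ : ∃ j, m = j + 1 := ⟨m - 1, by omega⟩
      have : (j : ℝ) < (u - x) / (2 * x) := Nat.lt_ceil.1 (by omega)
      rw [hj]; push_cast; linarith
  -- The excluded points `(2k+1)x` are those where `τ = 1`, the jumps of the periodic extension.
  have hτ1 : τ < 1 := by
    have h1 : (u - x) / (2 * x) ≤ m := Nat.le_ceil _
    have h2 : (u - x) / (2 * x) ≠ m := by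
      intro h
      rw [div_eq_iff h2x.ne'] at h
      exact hu' m (by linear_combination h)
    have := lt_of_le_of_ne h1 h2
    rw [hτ]; linarith
  have hlim := (tendsto_expFourierSum hA ⟨hτ0, hτ1⟩).const_mul
    (Real.exp (A / 2) * Real.exp (-A * u / (2 * x)))
  have hE : Real.exp A - 1 ≠ 0 := (sub_pos.2 (Real.one_lt_exp_iff.2 hA)).ne'
  have hE' : 1 - Real.exp (-A) ≠ 0 := by
    have : Real.exp (-A) < 1 := Real.exp_lt_one_iff.2 (by linarith)
    linarith
  have hval : Real.exp (A / 2) * Real.exp (-A * u / (2 * x)) *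
      (Real.exp (A * τ) / (Real.exp A - 1)) = inversionKernel A x u := by
    have h1 : Real.exp (A / 2) * Real.exp (-A * u / (2 * x)) * Real.exp (A * τ) =
        Real.exp (-A * m) * Real.exp A := by
      simp only [← Real.exp_add]
      congr 1
      rw [hτ]; field_simp; ring
    have h2 : Real.exp A * Real.exp (-A) = 1 := by rw [← Real.exp_add, add_neg_cancel, Real.exp_zero]
    rw [inversionKernel, ← hm, mul_div_assoc', div_eq_div_iff hE hE']
    linear_combination (1 - Real.exp (-A)) * h1 - Real.exp (-A * m) * h2
  rw [hval] at hlim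
  refine hlim.congr fun n => ?_
  rw [hτm, expFourierSum_add_nat]

/-- For `u ≤ x` the ceiling is `0` and the excess equals the upper bound exactly. For `u > x` the
ceiling is at least `1`, so the kernel itself lies between `0` and that bound. -/
theorem inversionKernel_bounds {A x : ℝ} (hA : 0 < A) (hx : 0 < x) (u : ℝ) :
    0 ≤ inversionKernel A x u - (Set.Iic x).indicator 1 u ∧
    inversionKernel A x u - (Set.Iic x).indicator 1 u ≤ Real.exp (-A) / (1 - Real.exp (-A)) := by
  have hq : 0 < 1 - Real.exp (-A) := by
    have : Real.exp (-A) < 1 := Real.exp_lt_one_iff.2 (by linarith)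
    linarith
  have hq0 := Real.exp_pos (-A)
  rw [inversionKernel]
  by_cases hu : u ≤ x
  · have : ⌈(u - x) / (2 * x)⌉₊ = 0 := by
      rw [Nat.ceil_eq_zero]
      exact div_nonpos_of_nonpos_of_nonneg (by linarith) (by linarith)
    rw [this, Set.indicator_of_mem (Set.mem_Iic.2 hu), Nat.cast_zero, mul_zero, Real.exp_zero,
      Pi.one_apply]
    have : 1 / (1 - Real.exp (-A)) - 1 = Real.exp (-A) / (1 - Real.exp (-A)) := by
      field_simp; ring
    rw [this]
    exact ⟨by positivity, le_rfl⟩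
  · rw [Set.indicator_of_notMem (by simpa using hu), sub_zero]
    refine ⟨by positivity, ?_⟩
    have h1 : (1 : ℝ) ≤ ⌈(u - x) / (2 * x)⌉₊ := by
      have : 0 < ⌈(u - x) / (2 * x)⌉₊ := Nat.ceil_pos.2 (div_pos (by linarith) (by linarith))
      exact_mod_cast this
    gcongr
    nlinarith

theorem measurable_inversionKernel (A x : ℝ) : Measurable (inversionKernel A x) := by
  unfold inversionKernel
  have : Measurable fun u : ℝ => ((⌈(u - x) / (2 * x)⌉₊ : ℕ) : ℝ) :=
    measurable_from_top.comp (Nat.measurable_ceil.comp (by fun_prop))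
  fun_prop

theorem integrable_inversionKernel {A x : ℝ} (hA : 0 < A) (hx : 0 < x) (ν : Measure ℝ)
    [IsFiniteMeasure ν] : Integrable (inversionKernel A x) ν := by
  refine Integrable.of_bound (measurable_inversionKernel A x).aestronglyMeasurable
    (1 + Real.exp (-A) / (1 - Real.exp (-A))) (Eventually.of_forall fun u => ?_)
  obtain ⟨h1, h2⟩ := inversionKernel_bounds hA hx u
  have h3 : 0 ≤ (Set.Iic x).indicator (1 : ℝ → ℝ) u :=
    Set.indicator_nonneg (fun _ _ => zero_le_one) _
  have h4 : (Set.Iic x).indicator (1 : ℝ → ℝ) u ≤ 1 :=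
    Set.indicator_le_self' (fun _ _ => zero_le_one) _
  rw [Real.norm_of_nonneg (by linarith)]
  linarith

theorem integrable_exp_neg_mul {ν : Measure ℝ} [IsFiniteMeasure ν] (hν : ∀ᵐ u ∂ν, 0 ≤ u) {s : ℂ}
    (hs : 0 ≤ s.re) : Integrable (fun u : ℝ => Complex.exp (-s * u)) ν := by
  refine Integrable.of_bound (by fun_prop) 1 ?_
  filter_upwards [hν] with u hu
  rw [Complex.norm_exp]
  refine Real.exp_le_one_iff.2 ?_
  simp only [neg_mul, Complex.neg_re, Complex.mul_re, Complex.ofReal_re, Complex.ofReal_im,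
    mul_zero, sub_zero]
  nlinarith [mul_nonneg hs hu]

/-- The Euler-summation inversion formula: for a probability measure on `[0, ∞)` without positive
atoms it converges, and it exceeds the distribution function by at most
`exp (-A) / (1 - exp (-A))`. -/
theorem exists_tendsto_eulerInversion {ν : Measure ℝ} [IsProbabilityMeasure ν]
    (hν : ∀ᵐ u ∂ν, 0 ≤ u) (hatom : ∀ c : ℝ, 0 < c → ν {c} = 0) {M : ℂ → ℂ}
    (hM : ∀ s : ℂ, 0 < s.re → M (-s) = ∫ u : ℝ, Complex.exp (-s * u) ∂ν)
    {x A : ℝ} (hx : 0 < x) (hA : 0 < A) :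
    ∃ ℓ : ℝ, Tendsto (fun p : ℕ × ℕ => FSO.eulerInversion M A p.1 p.2 x) cofinite (𝓝 ℓ) ∧
      0 ≤ ℓ - ν.real (Set.Iic x) ∧
      ℓ - ν.real (Set.Iic x) ≤ Real.exp (-A) / (1 - Real.exp (-A)) := by
  have h2x : 0 < 2 * x := by linarith
  refine ⟨∫ u, inversionKernel A x u ∂ν, ?_, ?_⟩
  · set G : ℕ → ℝ → ℝ := fun n u => Real.exp (A / 2) * Real.exp (-A * u / (2 * x)) *
      expFourierSum A n ((u + x) / (2 * x)) with hG
    have hlim : Tendsto (fun n => ∫ u, G n u ∂ν) atTop (𝓝 (∫ u, inversionKernel A x u ∂ν)) := by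
      obtain ⟨C, hC⟩ := exists_abs_expFourierSum_le hA
      refine tendsto_integral_of_dominated_convergence (fun _ => Real.exp (A / 2) * C)
        (fun n => ?_) (integrable_const _) (fun n => ?_) ?_
      · have := continuous_expFourierSum A n
        exact Continuous.aestronglyMeasurable (by rw [hG]; fun_prop)
      · filter_upwards [hν] with u hu
        rw [hG, norm_mul, Real.norm_eq_abs, Real.norm_eq_abs, abs_of_pos (by positivity)]
        have h1 : Real.exp (-A * u / (2 * x)) ≤ 1 := by
          refine Real.exp_le_one_iff.2 (div_nonpos_of_nonpos_of_nonneg ?_ h2x.le)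
          nlinarith
        have hC0 : 0 ≤ C := (abs_nonneg _).trans (hC 0 0)
        calc _ ≤ Real.exp (A / 2) * 1 * C := by gcongr; exact hC _ _
          _ = _ := by rw [mul_one]
      -- The jumps are countably many positive points, so they are null even if `ν` has an atom at
      -- `0`.
      · have hae : ∀ᵐ u ∂ν, ∀ k : ℕ, u ≠ (2 * k + 1) * x := by
          rw [ae_all_iff]
          intro k
          have := hatom ((2 * k + 1) * x) (by positivity)
          rw [ae_iff]
          simpa using this
        filter_upwards [hν, hae] with u hu hu'
        exact tendsto_inversionKernel hA hx hu hu'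
    refine (tendsto_binomial_average hlim).congr fun p => ?_
    obtain ⟨K, L⟩ := p
    have hterm : ∀ l : ℕ, (-1 : ℝ) ^ l *
          (M (-(((A : ℂ) + Complex.I * (2 * Real.pi * l)) / (2 * x))) /
            (((A : ℂ) + Complex.I * (2 * Real.pi * l)) / (2 * x))).re =
        ∫ u, 2 * x * Real.exp (-A * u / (2 * x)) *
          (Complex.exp (-(2 * Real.pi * l * ((u + x) / (2 * x)) : ℝ) * Complex.I) /
            (A + 2 * Real.pi * l * Complex.I)).re ∂ν := by
      intro l
      set s : ℂ := ((A : ℂ) + Complex.I * (2 * Real.pi * l)) / (2 * x) with hs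
      have hsre : 0 < s.re := by
        have : s = ((A / (2 * x) : ℝ) : ℂ) + ((2 * Real.pi * l / (2 * x) : ℝ) : ℂ) * Complex.I := by
          rw [hs]; push_cast; ring
        rw [this]
        simp only [Complex.add_re, Complex.re_ofReal_mul, Complex.I_re, mul_zero, add_zero,
          Complex.ofReal_re]
        positivity
      rw [hM s hsre, ← integral_div, ← RCLike.re_eq_complex_re, ← integral_re, ← integral_const_mul]
      · refine integral_congr_ae (Eventually.of_forall fun u => ?_)
        simp only [RCLike.re_eq_complex_re]
        rw [← Complex.re_ofReal_mul, ← Complex.re_ofReal_mul]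
        congr 1
        have hxc : (x : ℂ) ≠ 0 := by exact_mod_cast hx.ne'
        have hd : (A + 2 * Real.pi * l * Complex.I : ℂ) ≠ 0 := by
          intro h
          have := congrArg Complex.re h
          simp at this
          exact hA.ne' this
        have hs' : s = (A + 2 * Real.pi * l * Complex.I) / (2 * x) := by rw [hs]; ring
        -- The alternating sign of the inversion series is the half-period shift from `u/(2x)` to
        -- `(u + x)/(2x)`.
        have hexp : Complex.exp (-(2 * Real.pi * l * ((u + x) / (2 * x)) : ℝ) * Complex.I) =
            (-1) ^ l * Complex.exp (-(Real.pi * l * u / x : ℝ) * Complex.I) := by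
          have h1 : ((-1 : ℂ)) ^ l = Complex.exp (-(Real.pi * l) * Complex.I) := by
            rw [show (-(Real.pi * l) * Complex.I : ℂ) = l * -(Real.pi * Complex.I) by ring,
              Complex.exp_nat_mul, Complex.exp_neg, Complex.exp_pi_mul_I]
            norm_num
          rw [h1, ← Complex.exp_add]
          congr 1
          push_cast
          field_simp
          ring
        have hexp2 : Complex.exp (-s * u) = Complex.exp ((-A * u / (2 * x) : ℝ)) *
            Complex.exp (-(Real.pi * l * u / x : ℝ) * Complex.I) := by
          rw [← Complex.exp_add, hs']
          congr 1
          push_cast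
          field_simp
          ring
        rw [hexp, hexp2, hs']
        push_cast
        field_simp
      · exact (integrable_exp_neg_mul hν hsre.le).div_const _
    have hint : ∀ l : ℕ, Integrable (fun u : ℝ => 2 * x * Real.exp (-A * u / (2 * x)) *
          (Complex.exp (-(2 * Real.pi * l * ((u + x) / (2 * x)) : ℝ) * Complex.I) /
            (A + 2 * Real.pi * l * Complex.I)).re) ν := by
      intro l
      refine Integrable.of_bound (Continuous.aestronglyMeasurable (by fun_prop))
        (2 * x * (1 / ‖(A + 2 * Real.pi * l * Complex.I : ℂ)‖)) ?_
      filter_upwards [hν] with u hu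
      rw [norm_mul, Real.norm_of_nonneg (by positivity)]
      have h1 : Real.exp (-A * u / (2 * x)) ≤ 1 := by
        refine Real.exp_le_one_iff.2 (div_nonpos_of_nonpos_of_nonneg ?_ h2x.le)
        nlinarith
      calc _ ≤ 2 * x * 1 * (1 / ‖(A + 2 * Real.pi * l * Complex.I : ℂ)‖) := by
            gcongr
            refine (Complex.abs_re_le_norm _).trans ?_
            rw [norm_div, ← Complex.ofReal_neg, Complex.norm_exp_ofReal_mul_I]
        _ = _ := by rw [mul_one]
    have hs : ∀ n, ∫ u, G n u ∂ν = Real.exp (A / 2) / x *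
        (1 / 2 * (M (-((A : ℂ) / (2 * x))) / ((A : ℂ) / (2 * x))).re +
        ∑ l ∈ Finset.Icc 1 n, (-1 : ℝ) ^ l *
          (M (-(((A : ℂ) + Complex.I * (2 * Real.pi * l)) / (2 * x))) /
            (((A : ℂ) + Complex.I * (2 * Real.pi * l)) / (2 * x))).re) := by
      intro n
      have h0 := hterm 0
      simp only [Nat.cast_zero, mul_zero, add_zero, pow_zero, one_mul, zero_mul] at h0
      simp only [hterm, h0]
      rw [← integral_finsetSum _ fun l _ => hint l, ← integral_const_mul, ← integral_add,
        ← integral_const_mul]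
      · refine integral_congr_ae (Eventually.of_forall fun u => ?_)
        simp only [hG, expFourierSum, Complex.ofReal_zero, neg_zero, zero_mul, Complex.exp_zero]
        rw [← Finset.mul_sum, ← Complex.ofReal_one, ← Complex.ofReal_div, Complex.ofReal_re]
        generalize (∑ l ∈ Finset.Icc 1 n, (_ : ℝ)) = D
        field_simp
      · have := (hint 0).const_mul (1 / 2)
        simpa using this
      · exact integrable_finsetSum _ fun l _ => hint l
    simp only [FSO.eulerInversion]
    simp only [hs]
    rw [mul_div_assoc, mul_assoc, Finset.mul_sum (a := Real.exp (A / 2) / x)]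
    congr 1
    refine Finset.sum_congr rfl fun k _ => ?_
    ring
  · have h1 : ν.real (Set.Iic x) = ∫ u, (Set.Iic x).indicator 1 u ∂ν :=
      (integral_indicator_one measurableSet_Iic).symm
    have hind : Integrable ((Set.Iic x).indicator (1 : ℝ → ℝ)) ν :=
      (integrable_const (1 : ℝ)).indicator measurableSet_Iic
    rw [h1, ← integral_sub (integrable_inversionKernel hA hx ν) hind]
    constructor
    · exact integral_nonneg fun u => (inversionKernel_bounds hA hx u).1
    · have := integral_mono (μ := ν) ((integrable_inversionKernel hA hx ν).sub hind)
        (integrable_const (Real.exp (-A) / (1 - Real.exp (-A))))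
        fun u => (inversionKernel_bounds hA hx u).2
      simpa using this

/-! ### The Gamma-Gamma law as a product of two Gamma variables. -/

namespace FSO

/-- The Gamma-Gamma density as a mixture integral over the second Gamma factor. -/
theorem gammaGammaPDF_eq_integral {α β x : ℝ} (hα : 0 < α) (hβ : 0 < β) (hx : 0 < x) :
    gammaGammaPDF α β x = ∫ t in Set.Ioi (0 : ℝ),
      gammaPDFReal α 1 (α * β / t * x) * (α * β / t) * gammaPDFReal β 1 t := by
  have hab : 0 < α * β := by positivity
  rw [gammaGammaPDF, if_pos hx, besselK, ← mul_assoc, ← mul_assoc, ← integral_const_mul]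
  refine setIntegral_congr_fun measurableSet_Ioi fun t ht => ?_
  have ht' : 0 < t := ht
  have hq : 0 < α * β * x := by positivity
  -- The Bessel integration variable is the second Gamma variable `t`; this term is the value of the
  -- first one when the normalized product equals `x`.
  have hsq : (2 * √(α * β * x)) ^ 2 / (4 * t) = α * β / t * x := by
    rw [mul_pow, Real.sq_sqrt hq.le]; field_simp; ring
  have hpow : (2 * √(α * β * x) / 2) ^ (α - β) = (α * β * x) ^ ((α - β) / 2) := by
    rw [mul_div_cancel_left₀ _ two_ne_zero, Real.sqrt_eq_rpow, ← Real.rpow_mul hq.le]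
    congr 1; ring
  simp only [gammaPDFReal]
  rw [if_pos (by positivity), if_pos ht'.le, hsq, hpow, Real.one_rpow, Real.one_rpow,
    Real.mul_rpow hab.le hx.le, Real.mul_rpow (by positivity : 0 ≤ α * β / t) hx.le,
    Real.div_rpow hab.le ht'.le, Real.rpow_sub_one hab.ne', Real.rpow_sub_one ht'.ne',
    show -(α - β) = β - α by ring, Real.rpow_sub ht', Real.rpow_sub_one ht'.ne',
    sub_eq_add_neg (-t), Real.exp_add, Real.rpow_sub_one ht'.ne', Real.rpow_sub_one hx.ne' α]
  have h1 : (α * β) ^ α = (α * β) ^ ((α + β) / 2) * (α * β) ^ ((α - β) / 2) := by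
    rw [← Real.rpow_add hab]; congr 1; ring
  have h2 : x ^ α = x ^ ((α + β) / 2) * x ^ ((α - β) / 2) := by
    rw [← Real.rpow_add hx]; congr 1; ring
  have hG := (Real.Gamma_pos_of_pos hα).ne'
  have hG' := (Real.Gamma_pos_of_pos hβ).ne'
  have ht3 : t ^ α ≠ 0 := (Real.rpow_pos_of_pos ht' _).ne'
  rw [h1, h2, Real.rpow_sub_one hx.ne', one_mul, one_mul]
  field_simp

theorem lintegral_eq_mul_lintegral_comp_mul_left {c : ℝ} (hc : 0 < c) {f : ℝ → ENNReal}
    (hf : Measurable f) : ∫⁻ u, f u = ∫⁻ x, f (c * x) * ENNReal.ofReal c := by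
  rw [lintegral_mul_const _ (by fun_prop), ← lintegral_map hf (measurable_const_mul c),
    Real.map_volume_mul_left hc.ne', lintegral_smul_measure, smul_eq_mul, abs_of_pos (by positivity),
    mul_comm, ← mul_assoc, ← ENNReal.ofReal_mul hc.le, mul_inv_cancel₀ hc.ne', ENNReal.ofReal_one,
    one_mul]

/-- A Gamma-Gamma variable is the product of two independent Gamma variables of unit mean. -/
theorem gammaGamma_eq_map {α β : ℝ} (hα : 0 < α) (hβ : 0 < β) :
    gammaGamma α β = ((gammaMeasure α 1).prod (gammaMeasure β 1)).map
      fun p : ℝ × ℝ => p.1 * p.2 / (α * β) := by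
  have := isProbabilityMeasure_gammaMeasure hα one_pos
  have := isProbabilityMeasure_gammaMeasure hβ one_pos
  have hab : 0 < α * β := by positivity
  set k : ℝ → ℝ → ℝ := fun x t =>
    gammaPDFReal α 1 (α * β / t * x) * (α * β / t) * gammaPDFReal β 1 t with hk
  have hkm : Measurable (Function.uncurry k) := by
    rw [hk]; unfold Function.uncurry; simp only
    have h1 := measurable_gammaPDFReal α 1
    have h2 := measurable_gammaPDFReal β 1
    fun_prop
  set q : ℝ → ENNReal := fun x => ∫⁻ t in Set.Ioi 0, ENNReal.ofReal (k x t) with hq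
  have hqm : Measurable q := by
    rw [hq]
    exact Measurable.lintegral_prod_right' (f := fun p : ℝ × ℝ => ENNReal.ofReal (k p.1 p.2))
      (ENNReal.measurable_ofReal.comp hkm)
  have h0 : ∀ᵐ x : ℝ, x ≠ 0 := by simp [ae_iff]
  have hmap : ((gammaMeasure α 1).prod (gammaMeasure β 1)).map
      (fun p : ℝ × ℝ => p.1 * p.2 / (α * β)) = volume.withDensity q := by
    refine Measure.ext_of_lintegral _ fun g hg => ?_
    rw [lintegral_map hg (by fun_prop), lintegral_prod_symm _ (by fun_prop),
      lintegral_withDensity_eq_lintegral_mul _ hqm hg, gammaMeasure, gammaMeasure]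
    have hpm : ∀ a, Measurable (gammaPDF a 1) := fun a =>
      (measurable_gammaPDFReal a 1).ennreal_ofReal
    rw [lintegral_withDensity_eq_lintegral_mul _ (hpm β)
      (Measurable.lintegral_prod_left' (f := fun p : ℝ × ℝ => g (p.1 * p.2 / (α * β))) (by fun_prop))]
    have hsupp : ∀ h : ℝ → ENNReal, ∫⁻ t, gammaPDF β 1 t * h t =
        ∫⁻ t in Set.Ioi 0, gammaPDF β 1 t * h t := by
      intro h
      rw [← lintegral_indicator measurableSet_Ioi]
      refine lintegral_congr_ae ?_
      filter_upwards [h0] with t ht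
      rcases lt_or_gt_of_ne ht with h1 | h1
      · rw [gammaPDF_of_neg h1, zero_mul, Set.indicator_of_notMem (by simpa using h1.le)]
      · rw [Set.indicator_of_mem (Set.mem_Ioi.2 h1)]
    simp only [Pi.mul_apply]
    rw [hsupp]
    -- For fixed `t`, substitute `αβx/t` for the first Gamma variable; Tonelli then exchanges `x`
    -- and `t`.
    calc _ = ∫⁻ t in Set.Ioi 0, ∫⁻ x, ENNReal.ofReal (k x t) * g x := by
          refine setLIntegral_congr_fun measurableSet_Ioi fun t ht => ?_
          have ht' : 0 < t := ht
          have hc : 0 < α * β / t := by positivity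
          rw [lintegral_withDensity_eq_lintegral_mul _ (hpm α) (by fun_prop),
            lintegral_eq_mul_lintegral_comp_mul_left hc (((hpm α).mul (by fun_prop))),
            ← lintegral_const_mul _ (by have := hpm α; fun_prop)]
          refine lintegral_congr fun x => ?_
          simp only [Pi.mul_apply]
          rw [show α * β / t * x * t / (α * β) = x by field_simp, hk]
          simp only
          rw [ENNReal.ofReal_mul, ENNReal.ofReal_mul, gammaPDF, gammaPDF]
          · ring
          · exact gammaPDFReal_nonneg hα one_pos _
          · exact mul_nonneg (gammaPDFReal_nonneg hα one_pos _) hc.le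
      _ = ∫⁻ x, ∫⁻ t in Set.Ioi 0, ENNReal.ofReal (k x t) * g x := by
          rw [lintegral_lintegral_swap]
          have := ENNReal.measurable_ofReal.comp hkm
          refine Measurable.aemeasurable ?_
          have h2 : Measurable fun p : ℝ × ℝ => ENNReal.ofReal (k p.2 p.1) :=
            this.comp measurable_swap
          unfold Function.uncurry
          fun_prop
      _ = _ := by
          refine lintegral_congr fun x => ?_
          rw [lintegral_mul_const]
          exact (ENNReal.measurable_ofReal.comp hkm).comp measurable_prodMk_left
  rw [hmap, gammaGamma]
  -- `q` is the density of a probability measure. Its finiteness makes the Bochner integral for the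
  -- density agree with the Lebesgue one.
  have hfin : ∀ᵐ x, q x < ⊤ := by
    refine ae_lt_top hqm ?_
    have : volume.withDensity q Set.univ = 1 := by
      rw [← hmap, Measure.map_apply (by fun_prop) MeasurableSet.univ]
      simp
    rw [withDensity_apply _ MeasurableSet.univ, Measure.restrict_univ] at this
    rw [this]; exact ENNReal.one_ne_top
  refine withDensity_congr_ae ?_
  filter_upwards [hfin, h0] with x hx hx0
  have hnn : 0 ≤ᵐ[volume.restrict (Set.Ioi 0)] k x := by
    filter_upwards [ae_restrict_mem measurableSet_Ioi] with t ht
    have ht' : 0 < t := ht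
    exact mul_nonneg (mul_nonneg (gammaPDFReal_nonneg hα one_pos _) (by positivity))
      (gammaPDFReal_nonneg hβ one_pos _)
  have hkx : Measurable (k x) := hkm.comp measurable_prodMk_left
  rcases lt_or_gt_of_ne hx0 with hneg | hpos
  · rw [gammaGammaPDF, if_neg hneg.not_gt, ENNReal.ofReal_zero, hq]
    symm
    simp only
    rw [lintegral_eq_zero_iff (by fun_prop)]
    filter_upwards [ae_restrict_mem measurableSet_Ioi] with t ht
    have ht' : 0 < t := ht
    have : α * β / t * x < 0 := mul_neg_of_pos_of_neg (by positivity) hneg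
    simp [hk, gammaPDFReal, not_le.2 this]
  · rw [gammaGammaPDF_eq_integral hα hβ hpos, ofReal_integral_eq_lintegral_ofReal _ hnn]
    refine ⟨hkx.aestronglyMeasurable, ?_⟩
    rw [hasFiniteIntegral_iff_ofReal hnn]
    exact hx

end FSO

/-! ### Negative moments, and the Mellin transform of a distribution function. -/

namespace FSO

theorem norm_Gamma_le_Gamma_re {s : ℂ} (hs : 0 < s.re) : ‖Complex.Gamma s‖ ≤ Real.Gamma s.re := by
  rw [Complex.Gamma_eq_integral hs, Real.Gamma_eq_integral hs, Complex.GammaIntegral]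
  refine (norm_integral_le_integral_norm _).trans_eq ?_
  refine setIntegral_congr_fun measurableSet_Ioi fun x hx => ?_
  rw [norm_mul, Complex.norm_real, Real.norm_of_nonneg (Real.exp_pos _).le,
    Complex.norm_cpow_eq_rpow_re_of_pos hx, Complex.sub_re, Complex.one_re]

/-- Polynomial decay of the Gamma function along vertical lines. -/
theorem norm_Gamma_le_div {s : ℂ} (hs : 0 < s.re) :
    ‖Complex.Gamma s‖ ≤ Real.Gamma (s.re + 1) / ‖s‖ := by
  have h0 : s ≠ 0 := fun h => by simp [h] at hs
  rw [le_div_iff₀ (norm_pos_iff.2 h0), mul_comm, ← norm_mul, ← Complex.Gamma_add_one s h0]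
  have := norm_Gamma_le_Gamma_re (s := s + 1) (by simp; linarith)
  simpa using this

theorem measurable_gammaPDF (a r : ℝ) : Measurable (gammaPDF a r) :=
  (measurable_gammaPDFReal a r).ennreal_ofReal

section Moments

variable {a : ℝ} {s : ℂ}

theorem gammaPDF_smul_cpow_ae_eq (a : ℝ) (ha : 0 < a) (s : ℂ) :
    (fun u : ℝ => (gammaPDF a 1 u).toReal • (u : ℂ) ^ (-s)) =ᵐ[volume]
      (Set.Ioi (0 : ℝ)).indicator fun u : ℝ =>
        (Real.Gamma a : ℂ)⁻¹ * ((Real.exp (-u) : ℂ) * (u : ℂ) ^ (a - s - 1)) := by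
  have h0 : ∀ᵐ x : ℝ, x ≠ 0 := by simp [ae_iff]
  filter_upwards [h0] with u hu
  rcases lt_or_gt_of_ne hu with h1 | h1
  · rw [gammaPDF_of_neg h1, Set.indicator_of_notMem (by simpa using h1.le)]
    simp
  · have hpos := gammaPDFReal_nonneg ha one_pos u
    rw [Set.indicator_of_mem (Set.mem_Ioi.2 h1), gammaPDF, ENNReal.toReal_ofReal hpos,
      gammaPDFReal, if_pos h1.le, Complex.real_smul, Real.one_rpow, one_mul]
    push_cast
    rw [Complex.ofReal_cpow h1.le, show (a - s - 1 : ℂ) = (a - 1 : ℝ) + -s by push_cast; ring,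
      Complex.cpow_add _ _ (by exact_mod_cast hu)]
    ring

theorem integrable_cpow_neg_gammaMeasure (ha : 0 < a) (hs : s.re < a) :
    Integrable (fun u : ℝ => (u : ℂ) ^ (-s)) (gammaMeasure a 1) := by
  rw [gammaMeasure, integrable_withDensity_iff_integrable_smul'
    (measurable_gammaPDF a 1) (Eventually.of_forall fun _ => ENNReal.ofReal_lt_top),
    integrable_congr (gammaPDF_smul_cpow_ae_eq a ha s), integrable_indicator_iff measurableSet_Ioi]
  exact (Complex.GammaIntegral_convergent (s := a - s) (by simpa using hs)).const_mul _

theorem integral_cpow_neg_gammaMeasure (ha : 0 < a) (hs : s.re < a) :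
    ∫ u : ℝ, (u : ℂ) ^ (-s) ∂(gammaMeasure a 1) = Complex.Gamma (a - s) / Complex.Gamma a := by
  rw [gammaMeasure, integral_withDensity_eq_integral_toReal_smul
    (measurable_gammaPDF a 1) (Eventually.of_forall fun _ => ENNReal.ofReal_lt_top),
    integral_congr_ae (gammaPDF_smul_cpow_ae_eq a ha s), integral_indicator measurableSet_Ioi,
    integral_const_mul, Complex.Gamma_eq_integral (s := a - s) (by simpa using hs),
    Complex.GammaIntegral, Complex.Gamma_ofReal, div_eq_inv_mul]

theorem gammaMeasure_ae_pos (a : ℝ) : ∀ᵐ u ∂(gammaMeasure a 1), 0 < u := by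
  rw [gammaMeasure, ae_withDensity_iff (measurable_gammaPDF a 1)]
  have h0 : ∀ᵐ x : ℝ, x ≠ 0 := by simp [ae_iff]
  filter_upwards [h0] with u hu h
  by_contra hn
  exact h (gammaPDF_of_neg (lt_of_le_of_ne (not_lt.1 hn) hu))

end Moments

section GammaGamma

variable {α β : ℝ}

theorem isProbabilityMeasure_gammaGamma (hα : 0 < α) (hβ : 0 < β) :
    IsProbabilityMeasure (gammaGamma α β) := by
  have := isProbabilityMeasure_gammaMeasure hα one_pos
  have := isProbabilityMeasure_gammaMeasure hβ one_pos
  rw [gammaGamma_eq_map hα hβ]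
  exact Measure.isProbabilityMeasure_map (by fun_prop)

theorem gammaGamma_ae_pos (α β : ℝ) : ∀ᵐ u ∂(gammaGamma α β), 0 < u := by
  have hac : gammaGamma α β (Set.Iic 0) = 0 := by
    rw [gammaGamma, withDensity_apply _ measurableSet_Iic]
    refine (setLIntegral_congr_fun measurableSet_Iic fun x hx => ?_).trans lintegral_zero
    rw [gammaGammaPDF, if_neg (not_lt.2 hx), ENNReal.ofReal_zero]
  rw [ae_iff]
  simpa [Set.Iic] using hac

theorem gammaGamma_singleton (α β c : ℝ) : gammaGamma α β {c} = 0 :=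
  withDensity_absolutelyContinuous _ _ Real.volume_singleton

/-- Complex powers split over products of positive reals, and both Gamma factors are almost surely
positive. -/
theorem cpow_neg_mul_div_ae_eq (hα : 0 < α) (hβ : 0 < β) (s : ℂ) :
    (fun p : ℝ × ℝ => ((p.1 * p.2 / (α * β) : ℝ) : ℂ) ^ (-s))
      =ᵐ[(gammaMeasure α 1).prod (gammaMeasure β 1)]
    fun p => ((α * β : ℝ) : ℂ) ^ s * ((p.1 : ℂ) ^ (-s) * (p.2 : ℂ) ^ (-s)) := by
  have := isProbabilityMeasure_gammaMeasure hα one_pos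
  have := isProbabilityMeasure_gammaMeasure hβ one_pos
  have hab : 0 < α * β := by positivity
  have h1 : ∀ᵐ p ∂((gammaMeasure α 1).prod (gammaMeasure β 1)), 0 < p.1 :=
    Measure.quasiMeasurePreserving_fst.ae (gammaMeasure_ae_pos α)
  have h2 : ∀ᵐ p ∂((gammaMeasure α 1).prod (gammaMeasure β 1)), 0 < p.2 :=
    Measure.quasiMeasurePreserving_snd.ae (gammaMeasure_ae_pos β)
  filter_upwards [h1, h2] with p hp1 hp2
  rw [div_eq_mul_inv, Complex.ofReal_mul, Complex.mul_cpow_ofReal_nonneg (by positivity)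
    (by positivity), Complex.ofReal_mul p.1, Complex.mul_cpow_ofReal_nonneg hp1.le hp2.le,
    Complex.ofReal_inv, Complex.inv_cpow, Complex.cpow_neg ((α * β : ℝ) : ℂ) s, inv_inv, mul_comm]
  rw [Complex.arg_ofReal_of_nonneg hab.le]
  exact Real.pi_pos.ne

theorem integrable_cpow_neg_gammaGamma (hα : 0 < α) (hβ : 0 < β) {s : ℂ} (hsα : s.re < α)
    (hsβ : s.re < β) : Integrable (fun u : ℝ => (u : ℂ) ^ (-s)) (gammaGamma α β) := by
  have := isProbabilityMeasure_gammaMeasure hα one_pos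
  have := isProbabilityMeasure_gammaMeasure hβ one_pos
  rw [gammaGamma_eq_map hα hβ, integrable_map_measure
    (Measurable.aestronglyMeasurable (by fun_prop)) (by fun_prop)]
  exact (((integrable_cpow_neg_gammaMeasure hα hsα).mul_prod
    (integrable_cpow_neg_gammaMeasure hβ hsβ)).const_mul _).congr
    (cpow_neg_mul_div_ae_eq hα hβ s).symm

theorem integral_cpow_neg_gammaGamma (hα : 0 < α) (hβ : 0 < β) {s : ℂ} (hsα : s.re < α)
    (hsβ : s.re < β) : ∫ u : ℝ, (u : ℂ) ^ (-s) ∂(gammaGamma α β) =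
      ((α * β : ℝ) : ℂ) ^ s * (Complex.Gamma (α - s) / Complex.Gamma α *
        (Complex.Gamma (β - s) / Complex.Gamma β)) := by
  have := isProbabilityMeasure_gammaMeasure hα one_pos
  have := isProbabilityMeasure_gammaMeasure hβ one_pos
  rw [gammaGamma_eq_map hα hβ, integral_map (by fun_prop)
    (Measurable.aestronglyMeasurable (by fun_prop)),
    integral_congr_ae (cpow_neg_mul_div_ae_eq hα hβ s), integral_const_mul, integral_prod_mul
      (fun u : ℝ => (u : ℂ) ^ (-s)) (fun u : ℝ => (u : ℂ) ^ (-s)),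
    integral_cpow_neg_gammaMeasure hα hsα, integral_cpow_neg_gammaMeasure hβ hsβ]

end GammaGamma

section MellinCdf

variable {ν : Measure ℝ} [IsFiniteMeasure ν] {s : ℂ}

theorem integral_indicator_cpow {u : ℝ} (hu : 0 < u) (hs : 0 < s.re) :
    IntegrableOn (fun t : ℝ => (Set.Ici u).indicator (fun t : ℝ => (t : ℂ) ^ (-s - 1)) t)
      (Set.Ioi 0) ∧
    ∫ t in Set.Ioi (0 : ℝ), (Set.Ici u).indicator (fun t : ℝ => (t : ℂ) ^ (-s - 1)) t =
      (u : ℂ) ^ (-s) / s := by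
  have hsub : Set.Ici u ∩ Set.Ioi 0 = Set.Ici u :=
    Set.inter_eq_left.2 fun t ht => lt_of_lt_of_le hu ht
  have hre : (-s - 1).re < -1 := by simp; linarith
  have h0 : s ≠ 0 := fun h => by simp [h] at hs
  constructor
  · rw [IntegrableOn, integrable_indicator_iff measurableSet_Ici, IntegrableOn,
      Measure.restrict_restrict measurableSet_Ici, hsub]
    exact (integrableOn_Ici_iff_integrableOn_Ioi).2 (integrableOn_Ioi_cpow_of_lt hre hu)
  · rw [integral_indicator measurableSet_Ici, Measure.restrict_restrict measurableSet_Ici, hsub,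
      integral_Ici_eq_integral_Ioi, integral_Ioi_cpow_of_lt hre hu, sub_add_cancel, neg_div_neg_eq]

/-- The Mellin transform of the distribution function of a positive random variable, in terms of
its negative moments. -/
theorem mellin_measureReal_Iic (hν : ∀ᵐ u ∂ν, 0 < u) (hs : 0 < s.re)
    (hint : Integrable (fun u : ℝ => (u : ℂ) ^ (-s)) ν) :
    MellinConvergent (fun t => ((ν.real (Set.Iic t) : ℝ) : ℂ)) (-s) ∧
    mellin (fun t => ((ν.real (Set.Iic t) : ℝ) : ℂ)) (-s) = (∫ u : ℝ, (u : ℂ) ^ (-s) ∂ν) / s := by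
  -- Integrating `H` over `u` gives the Mellin integrand; integrating over `t` gives `u^(-s)/s`.
  -- Fubini is justified by the same computation with `s.re` in place of `s`.
  set H : ℝ × ℝ → ℂ := fun p => (Set.Ici p.2).indicator (fun t : ℝ => (t : ℂ) ^ (-s - 1)) p.1 with hH
  have hHm : Measurable H := by
    have : H = Set.indicator {p : ℝ × ℝ | p.2 ≤ p.1} fun p => (p.1 : ℂ) ^ (-s - 1) := by
      ext p; simp [hH, Set.indicator]
    rw [this]
    exact Measurable.indicator (by fun_prop) (measurableSet_le measurable_snd measurable_fst)
  have hHint : Integrable H ((volume.restrict (Set.Ioi 0)).prod ν) := by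
    rw [integrable_prod_iff' hHm.aestronglyMeasurable]
    constructor
    · filter_upwards [hν] with u hu
      exact (integral_indicator_cpow hu hs).1
    · refine (hint.norm.div_const s.re).congr ?_
      filter_upwards [hν] with u hu
      have hs' : 0 < ((s.re : ℝ) : ℂ).re := by simpa using hs
      have h1 := (integral_indicator_cpow hu hs').2
      have h2 : ((‖(u : ℂ) ^ (-s)‖ / s.re : ℝ) : ℂ) = (u : ℂ) ^ (-(s.re : ℂ)) / s.re := by
        rw [Complex.norm_cpow_eq_rpow_re_of_pos hu, Complex.neg_re, Complex.ofReal_div,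
          Complex.ofReal_cpow hu.le, Complex.ofReal_neg]
      have h3 : ((∫ t in Set.Ioi (0 : ℝ), ‖H (t, u)‖ : ℝ) : ℂ) = (u : ℂ) ^ (-(s.re : ℂ)) / s.re := by
        rw [← h1, ← integral_complex_ofReal]
        refine setIntegral_congr_fun measurableSet_Ioi fun t ht => ?_
        have ht' : 0 < t := ht
        simp only [hH]
        by_cases htu : t ∈ Set.Ici u
        · rw [Set.indicator_of_mem htu, Set.indicator_of_mem htu,
            Complex.norm_cpow_eq_rpow_re_of_pos ht', Complex.ofReal_cpow ht'.le]
          simp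
        · rw [Set.indicator_of_notMem htu, Set.indicator_of_notMem htu, norm_zero,
            Complex.ofReal_zero]
      exact_mod_cast h2.trans h3.symm
  have hinner : ∀ t : ℝ, ∫ u, H (t, u) ∂ν = (t : ℂ) ^ (-s - 1) • ((ν.real (Set.Iic t) : ℝ) : ℂ) := by
    intro t
    have : (fun u => H (t, u)) = (Set.Iic t).indicator fun _ => (t : ℂ) ^ (-s - 1) := by
      ext u; simp [hH, Set.indicator]
    rw [this, integral_indicator_const _ measurableSet_Iic, Complex.real_smul, smul_eq_mul, mul_comm]
  constructor
  · have := hHint.integral_prod_left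
    simp only [hinner] at this
    exact this
  · rw [mellin]
    simp only [← hinner]
    rw [integral_integral_swap hHint, ← integral_div]
    refine integral_congr_ae ?_
    filter_upwards [hν] with u hu
    exact (integral_indicator_cpow hu hs).2

end MellinCdf

end FSO

/-! ### The Gamma-Gamma distribution function as a Meijer function. -/

namespace FSO

/-- The upper parameter `1` and the lower parameter `0` contribute `Γ(s)/Γ(1+s) = 1/s`. -/
theorem meijerGIntegrand_outage (α β : ℝ) (z : ℂ) {s : ℂ} (hs : 0 < s.re) :
    meijerGIntegrand 2 1 ![1] ![(α : ℂ), (β : ℂ), 0] z s =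
      Complex.Gamma (α - s) * Complex.Gamma (β - s) / s * z ^ s := by
  have h0 : s ≠ 0 := fun h => by simp [h] at hs
  have hG : Complex.Gamma s ≠ 0 := Complex.Gamma_ne_zero_of_re_pos hs
  simp only [meijerGIntegrand, Fin.prod_univ_three, Fin.prod_univ_one]
  congr 1
  simp
  rw [add_comm 1 s, Complex.Gamma_add_one s h0]
  field_simp

/-- Vertical integrability of the Mellin-Barnes integrand of the Gamma-Gamma distribution
function. -/
theorem integrable_Gamma_mul_Gamma_div {α β c : ℝ} (hc : 0 < c) (hcα : c < α) (hcβ : c < β) :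
    Integrable fun t : ℝ => Complex.Gamma (α - (c + t * Complex.I)) *
      Complex.Gamma (β - (c + t * Complex.I)) / (c + t * Complex.I) := by
  have hre : ∀ (σ t : ℝ), ((σ : ℂ) - (c + t * Complex.I)).re = σ - c := by intro σ t; simp
  have hcont : ∀ {σ : ℝ}, c < σ → Continuous fun t : ℝ => Complex.Gamma (σ - (c + t * Complex.I)) := by
    intro σ hσ
    rw [continuous_iff_continuousAt]
    intro t
    refine ContinuousAt.comp (g := Complex.Gamma) ?_ (by fun_prop)
    refine (Complex.differentiableAt_Gamma _ fun m h => ?_).continuousAt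
    have := congrArg Complex.re h
    rw [hre] at this
    simp at this
    have hm : (0 : ℝ) ≤ m := Nat.cast_nonneg _
    linarith
  have hne : ∀ t : ℝ, (c + t * Complex.I : ℂ) ≠ 0 := by
    intro t h
    have := congrArg Complex.re h
    simp at this
    exact hc.ne' this
  -- Both `‖s‖` and `‖α - s‖` are at least `κ √(1 + t²)` on the line. One factor from `1/s` and one
  -- from the decay of a single Gamma factor already give `1/(1 + t²)`; the other Gamma factor need
  -- only be bounded.
  set κ : ℝ := min 1 (min c (α - c)) with hκ
  have hκ0 : 0 < κ := lt_min one_pos (lt_min hc (by linarith))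
  have hκ1 : κ ≤ 1 := min_le_left _ _
  have hκc : κ ≤ c := (min_le_right _ _).trans (min_le_left _ _)
  have hκα : κ ≤ α - c := (min_le_right _ _).trans (min_le_right _ _)
  have hnorm : ∀ (x y : ℝ), κ ≤ x → κ * √(1 + y ^ 2) ≤ ‖(⟨x, y⟩ : ℂ)‖ := by
    intro x y hx
    rw [Complex.norm_def, Complex.normSq_mk]
    rw [← Real.sqrt_sq hκ0.le, ← Real.sqrt_mul (by positivity)]
    apply Real.sqrt_le_sqrt
    have h1 : κ ^ 2 ≤ x ^ 2 := by gcongr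
    have h2 : κ ^ 2 ≤ 1 := by nlinarith
    nlinarith [sq_nonneg y]
  set B : ℝ := Real.Gamma (α - c + 1) * Real.Gamma (β - c) / κ ^ 2
  refine Integrable.mono' (integrable_inv_one_add_sq.const_mul B) ?_
    (Eventually.of_forall fun t => ?_)
  · exact (((hcont hcα).mul (hcont hcβ)).div (by fun_prop) hne).aestronglyMeasurable
  · have h1 := norm_Gamma_le_div (s := (α : ℂ) - (c + t * Complex.I)) (by rw [hre]; linarith)
    have h2 := norm_Gamma_le_Gamma_re (s := (β : ℂ) - (c + t * Complex.I)) (by rw [hre]; linarith)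
    rw [hre] at h1 h2
    have hq : 0 < √(1 + t ^ 2) := Real.sqrt_pos.2 (by positivity)
    have h3 : κ * √(1 + t ^ 2) ≤ ‖(α : ℂ) - (c + t * Complex.I)‖ := by
      have := hnorm (α - c) (-t) hκα
      rw [neg_sq] at this
      refine this.trans_eq (congrArg _ ?_)
      apply Complex.ext <;> simp
    have h4 : κ * √(1 + t ^ 2) ≤ ‖(c + t * Complex.I : ℂ)‖ := by
      refine (hnorm c t hκc).trans_eq (congrArg _ ?_)
      apply Complex.ext <;> simp
    have hG1 : 0 < Real.Gamma (α - c + 1) := Real.Gamma_pos_of_pos (by linarith)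
    have hG2 : 0 < Real.Gamma (β - c) := Real.Gamma_pos_of_pos (by linarith)
    rw [norm_div, norm_mul]
    calc _ ≤ Real.Gamma (α - c + 1) / (κ * √(1 + t ^ 2)) * Real.Gamma (β - c) /
          (κ * √(1 + t ^ 2)) := by
          gcongr
          exact h1.trans (by gcongr)
      _ = Real.Gamma (α - c + 1) * Real.Gamma (β - c) / (κ ^ 2 * (√(1 + t ^ 2)) ^ 2) := by
          field_simp
      _ = _ := by
          rw [Real.sq_sqrt (by positivity), ← div_div, div_eq_mul_inv _ (1 + t ^ 2)]

/-- The jump of the distribution function at a point is the mass of that point. Mellin inversion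
requires this continuity. -/
theorem continuous_measureReal_Iic (ν : Measure ℝ) [IsProbabilityMeasure ν] (hν : ∀ c, ν {c} = 0) :
    Continuous fun t => ν.real (Set.Iic t) := by
  have hl : ∀ x, Function.leftLim (cdf ν) x = cdf ν x := by
    intro x
    have h := StieltjesFunction.measure_singleton (cdf ν) x
    rw [measure_cdf, hν, eq_comm, ENNReal.ofReal_eq_zero] at h
    exact le_antisymm ((monotone_cdf ν).leftLim_le le_rfl) (by linarith)
  have : (fun t => ν.real (Set.Iic t)) = cdf ν := by ext t; rw [cdf_eq_real]
  rw [this, continuous_iff_continuousAt]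
  intro x
  rw [continuousAt_iff_continuous_left'_right']
  refine ⟨?_, ((cdf ν).right_continuous x).mono Set.Ioi_subset_Ici_self⟩
  rw [(monotone_cdf ν).continuousWithinAt_Iio_iff_leftLim_eq]
  exact hl x

/-- The Gamma-Gamma distribution function as a Meijer `G`-function. -/
theorem meijerG_eq_gammaGamma_Iic {α β y : ℝ} (hα : 0 < α) (hβ : 0 < β) (hy : 0 < y) :
    1 / (Complex.Gamma α * Complex.Gamma β) *
      meijerG 2 1 ![1] ![(α : ℂ), (β : ℂ), 0] ((α * β * y : ℝ) : ℂ) =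
      (((gammaGamma α β).real (Set.Iic y) : ℝ) : ℂ) := by
  have := isProbabilityMeasure_gammaGamma hα hβ
  set a : Fin 1 → ℂ := ![1] with ha
  set b : Fin 3 → ℂ := ![(α : ℂ), (β : ℂ), 0] with hb
  have hex : ∃ c : ℝ, SeparatesPoles 2 1 a b c := by
    refine ⟨min α β / 2, ?_, ?_⟩
    · have h1 := min_le_left α β
      have h2 := min_le_right α β
      have h3 := lt_min hα hβ
      intro j hj
      fin_cases j
      · simp [hb]; linarith
      · simp [hb]; linarith
      · simp at hj
    · intro j _
      fin_cases j
      simp [ha, hα, hβ]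
  rw [meijerG, dif_pos hex]
  -- Only `0 < c < min α β` is known of the chosen line. Mellin inversion holds on each such line,
  -- so no contour shift is needed.
  set c : ℝ := hex.choose with hc
  obtain ⟨hc1, hc2⟩ := hex.choose_spec
  rw [← hc] at hc1 hc2
  have hcα : c < α := by simpa [hb] using hc1 0 (by norm_num)
  have hcβ : c < β := by simpa [hb] using hc1 1 (by norm_num)
  have hc0 : 0 < c := by simpa [ha] using hc2 0 (by norm_num)
  have hre : ∀ t : ℝ, (c + t * Complex.I : ℂ).re = c := by intro t; simp
  set F : ℝ → ℂ := fun t => (((gammaGamma α β).real (Set.Iic t) : ℝ) : ℂ) with hF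
  have hmellin : ∀ t : ℝ, mellin F (-(c + t * Complex.I)) =
      ((α * β : ℝ) : ℂ) ^ (c + t * Complex.I : ℂ) * (1 / (Complex.Gamma α * Complex.Gamma β)) *
      (Complex.Gamma (α - (c + t * Complex.I)) *
      Complex.Gamma (β - (c + t * Complex.I)) / (c + t * Complex.I)) := by
    intro t
    rw [(mellin_measureReal_Iic (gammaGamma_ae_pos α β) (by rwa [hre])
      (integrable_cpow_neg_gammaGamma hα hβ (by rwa [hre]) (by rwa [hre]))).2,
      integral_cpow_neg_gammaGamma hα hβ (by rwa [hre]) (by rwa [hre])]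
    field_simp
  have hconv : MellinConvergent F ((-c : ℝ) : ℂ) := by
    have := (mellin_measureReal_Iic (gammaGamma_ae_pos α β) (s := c) (by simpa using hc0)
      (integrable_cpow_neg_gammaGamma hα hβ (by simpa using hcα) (by simpa using hcβ))).1
    simpa using this
  have hab : 0 < α * β := by positivity
  have hvert : Complex.VerticalIntegrable (mellin F) (-c) := by
    have h : Integrable fun t : ℝ => mellin F (-(c + t * Complex.I)) := by
      simp only [hmellin]
      refine (integrable_Gamma_mul_Gamma_div hc0 hcα hcβ).bdd_mul
        (c := (α * β) ^ c * ‖1 / (Complex.Gamma α * Complex.Gamma β)‖) ?_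
        (Eventually.of_forall fun t => ?_)
      · refine Continuous.aestronglyMeasurable (Continuous.mul ?_ continuous_const)
        exact Continuous.const_cpow (by fun_prop) (Or.inl (by exact_mod_cast hab.ne'))
      · rw [norm_mul, Complex.norm_cpow_eq_rpow_re_of_pos hab, hre]
    have h2 := h.comp_neg
    rw [Complex.VerticalIntegrable]
    refine h2.congr (Eventually.of_forall fun t => ?_)
    simp only
    congr 1
    push_cast; ring
  have hcontF : ContinuousAt F y :=
    (Complex.continuous_ofReal.comp (continuous_measureReal_Iic _
      (gammaGamma_singleton α β))).continuousAt
  have hinv := mellinInv_mellin_eq (-c) F hy hconv hvert hcontF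
  -- The Mellin variable is `-s`; reversing `t` matches the orientation of the Mellin-Barnes line.
  rw [mellinInv, ← integral_neg_eq_self] at hinv
  change _ = F y
  rw [← hinv, Complex.real_smul, mul_left_comm]
  push_cast
  rw [one_div (2 * Real.pi : ℂ)]
  congr 1
  rw [← integral_const_mul]
  congr 1
  ext t
  have hneg : (-c + -t * Complex.I : ℂ) = -(c + t * Complex.I) := by ring
  rw [meijerGIntegrand_outage α β _ (by rwa [hre]), hneg, hmellin, neg_neg,
    ← Complex.ofReal_mul α β, Complex.mul_cpow_ofReal_nonneg hab.le hy.le, smul_eq_mul]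
  ring

end FSO

namespace FSO
-- Decoding probabilities and the law of the weighted gain.
namespace RelaySystem

variable {N : ℕ} (sys : RelaySystem N)

theorem powerMargin_pos : 0 < sys.powerMargin := by
  have h1 := sys.η_pos; have h2 := sys.Tb_pos; have h3 := sys.Pt_pos
  have h4 := sys.N0_pos; have h5 := sys.γth_pos
  rw [powerMargin]; positivity

theorem snr_eq (g : ℝ) : sys.snr g = sys.γth * (sys.powerMargin * g) ^ 2 := by
  have h4 := sys.N0_pos; have h5 := sys.γth_pos
  rw [snr, powerMargin, mul_pow, div_pow, Real.sq_sqrt (by positivity)]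
  field_simp

theorem lt_snr_iff {g : ℝ} (hg : 0 ≤ g) : sys.γth < sys.snr g ↔ 1 / sys.powerMargin < g := by
  have hP := sys.powerMargin_pos
  rw [snr_eq, lt_mul_iff_one_lt_right sys.γth_pos, one_lt_sq_iff₀ (by positivity),
    div_lt_iff₀' hP]

theorem snr_lt_iff {g : ℝ} (hg : 0 ≤ g) : sys.snr g < sys.γth ↔ g < 1 / sys.powerMargin := by
  have hP := sys.powerMargin_pos
  rw [snr_eq, mul_lt_iff_lt_one_right sys.γth_pos, sq_lt_one_iff₀ (by positivity),
    lt_div_iff₀' hP]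

/-- The threshold for the turbulence factor of a link above which the link is not in outage. -/
noncomputable def turbulenceThreshold (l : Link) : ℝ := 1 / (l.pathLoss * l.ρ * sys.powerMargin)

theorem turbulenceThreshold_pos (l : Link) : 0 < sys.turbulenceThreshold l := by
  have h1 := l.pathLoss_pos; have h2 := l.ρ_pos; have h3 := sys.powerMargin_pos
  rw [turbulenceThreshold]; positivity

theorem linkOutage_eq (l : Link) : sys.linkOutage l =
    (((gammaGamma l.α l.β).real (Set.Iic (sys.turbulenceThreshold l)) : ℝ) : ℂ) := by
  have h1 := l.pathLoss_pos; have h2 := l.ρ_pos; have h3 := sys.powerMargin_pos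
  rw [← meijerG_eq_gammaGamma_Iic l.α_pos l.β_pos (sys.turbulenceThreshold_pos l), linkOutage,
    turbulenceThreshold]
  congr 3
  field_simp

theorem lt_snr_gain_iff (l : Link) {y : ℝ} (hy : 0 < y) :
    sys.γth < sys.snr (l.ρ * l.gain y) ↔ sys.turbulenceThreshold l < y := by
  have h1 := l.pathLoss_pos; have h2 := l.ρ_pos; have h3 := sys.powerMargin_pos
  rw [Link.gain, sys.lt_snr_iff (by positivity), turbulenceThreshold, div_lt_iff₀ (by positivity),
    div_lt_iff₀ (by positivity)]
  ring_nf

/-- An empty decoding set gives an empty sum and SNR `0`, below the positive threshold, so it needs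
no separate case. -/
theorem outage_iff (x y : Fin N → ℝ) :
    sys.Outage x y ↔ sys.snr (sys.weightedGain (sys.decodingSet x) y) < sys.γth := by
  rw [Outage, or_iff_right_iff_imp]
  intro h
  rw [h, weightedGain, Finset.sum_empty, snr_eq, mul_zero]
  simpa using sys.γth_pos

theorem measurable_weightedGain (S : Finset (Fin N)) : Measurable (sys.weightedGain S) := by
  unfold weightedGain Link.gain
  fun_prop

theorem measurable_snr : Measurable sys.snr := by
  unfold snr
  fun_prop

theorem weightedGain_nonneg (S : Finset (Fin N)) {y : Fin N → ℝ} (hy : ∀ m, 0 < y m) :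
    0 ≤ sys.weightedGain S y := by
  refine Finset.sum_nonneg fun m _ => ?_
  have h1 := (sys.RD m).pathLoss_pos; have h2 := (sys.RD m).ρ_pos; have h3 := hy m
  rw [Link.gain]; positivity

theorem measurableSet_decodingSet_eq (S : Finset (Fin N)) :
    MeasurableSet {x : Fin N → ℝ | sys.decodingSet x = S} := by
  have : {x : Fin N → ℝ | sys.decodingSet x = S} =
      ⋂ m, {x | sys.γth < sys.snr ((sys.SR m).ρ * (sys.SR m).gain (x m)) ↔ m ∈ S} := by
    ext x
    simp [decodingSet, Finset.ext_iff]
  rw [this]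
  refine MeasurableSet.iInter fun m => ?_
  have hm : MeasurableSet {x : Fin N → ℝ | sys.γth < sys.snr ((sys.SR m).ρ * (sys.SR m).gain (x m))} := by
    refine measurableSet_lt measurable_const (sys.measurable_snr.comp ?_)
    unfold Link.gain
    fun_prop
  by_cases hS : m ∈ S
  · simp only [hS, iff_true]
    exact hm
  · simp only [hS, iff_false]
    exact hm.compl

section Probability

variable {Ω : Type*} [MeasurableSpace Ω] {μ : Measure Ω}

theorem measureReal_decodingSet_eq {h : Fin N → Ω → ℝ}
    (law : ∀ m, HasLaw (h m) (gammaGamma (sys.SR m).α (sys.SR m).β) μ) (indep : iIndepFun h μ)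
    (S : Finset (Fin N)) :
    ((μ.real {ω | sys.decodingSet (fun m => h m ω) = S} : ℝ) : ℂ) = sys.decodingWeight S := by
  classical
  -- The SNR squares the gain, so it translates into a one-sided threshold only for nonnegative
  -- gains.
  have hpos : ∀ᵐ ω ∂μ, ∀ m, 0 < h m ω := by
    rw [ae_all_iff]
    exact fun m => ((law m).ae_iff (p := fun y => 0 < y) (by fun_prop)).2 (gammaGamma_ae_pos _ _)
  set sets : Fin N → Set ℝ := fun m => if m ∈ S then Set.Ioi (sys.turbulenceThreshold (sys.SR m))
    else Set.Iic (sys.turbulenceThreshold (sys.SR m)) with hsets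
  have hmeas : ∀ m, MeasurableSet (sets m) := by
    intro m
    simp only [hsets]
    split_ifs
    · exact measurableSet_Ioi
    · exact measurableSet_Iic
  have hae : {ω | sys.decodingSet (fun m => h m ω) = S} =ᵐ[μ] ⋂ m ∈ Finset.univ, h m ⁻¹' sets m := by
    filter_upwards [hpos] with ω hω
    refine propext ?_
    change sys.decodingSet (fun m => h m ω) = S ↔ ω ∈ ⋂ m ∈ Finset.univ, h m ⁻¹' sets m
    simp only [decodingSet, Finset.ext_iff, Finset.mem_filter, Finset.mem_univ, true_and,
      Set.mem_iInter, Set.mem_preimage, forall_true_left]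
    refine forall_congr' fun m => ?_
    rw [sys.lt_snr_gain_iff _ (hω m)]
    by_cases hm : m ∈ S <;> simp [hsets, hm]
  have hq : ∀ m, μ.real (h m ⁻¹' sets m) = if m ∈ S then
      1 - (gammaGamma (sys.SR m).α (sys.SR m).β).real (Set.Iic (sys.turbulenceThreshold (sys.SR m)))
      else (gammaGamma (sys.SR m).α (sys.SR m).β).real
        (Set.Iic (sys.turbulenceThreshold (sys.SR m))) := by
    intro m
    have := isProbabilityMeasure_gammaGamma (sys.SR m).α_pos (sys.SR m).β_pos
    have h1 := (law m).measureReal_eq (p := fun y => y ∈ sets m) (hmeas m)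
    change μ.real (h m ⁻¹' sets m) = (gammaGamma (sys.SR m).α (sys.SR m).β).real (sets m) at h1
    rw [h1]
    simp only [hsets]
    split_ifs
    · rw [← Set.compl_Iic, probReal_compl_eq_one_sub measurableSet_Iic]
    · rfl
  rw [measureReal_congr hae, measureReal_def,
    indep.measure_inter_preimage_eq_mul _ fun m _ => hmeas m, ENNReal.toReal_prod]
  simp only [← measureReal_def, hq]
  rw [decodingWeight, ← Finset.prod_mul_prod_compl S, Complex.ofReal_mul, Complex.ofReal_prod,
    Complex.ofReal_prod]
  congr 1
  · refine Finset.prod_congr rfl fun m hm => ?_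
    rw [if_pos hm, linkOutage_eq]; push_cast; rfl
  · refine Finset.prod_congr rfl fun m hm => ?_
    rw [if_neg (Finset.mem_compl.1 hm), linkOutage_eq]

theorem aemeasurable_weightedGain {h : Fin N → Ω → ℝ} (hm : ∀ m, AEMeasurable (h m) μ)
    (S : Finset (Fin N)) : AEMeasurable (fun ω => sys.weightedGain S fun m => h m ω) μ :=
  (sys.measurable_weightedGain S).comp_aemeasurable (aemeasurable_pi_lambda _ hm)

/-- The weighted sum of the gains over any set of relays has no positive atoms. -/
theorem measure_weightedGain_eq [IsProbabilityMeasure μ] {h : Fin N → Ω → ℝ}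
    (law : ∀ m, HasLaw (h m) (gammaGamma (sys.RD m).α (sys.RD m).β) μ) (indep : iIndepFun h μ)
    (S : Finset (Fin N)) {c : ℝ} (hc : 0 < c) :
    μ {ω | sys.weightedGain S (fun m => h m ω) = c} = 0 := by
  -- The empty sum is an atom at `0`, hence the restriction to `c > 0`. Otherwise one link is split
  -- off: conditionally on the independent rest, it would have to hit a single point.
  rcases S.eq_empty_or_nonempty with rfl | ⟨m, hm⟩
  · simp [weightedGain, hc.ne]
  set g : Fin N → Ω → ℝ := fun i ω => (sys.RD i).ρ * (sys.RD i).gain (h i ω) with hg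
  have hgm : ∀ i, AEMeasurable (g i) μ := fun i => by
    have := (law i).aemeasurable
    simp only [hg, Link.gain]
    fun_prop
  have hgi : iIndepFun g μ := indep.comp (fun i y => (sys.RD i).ρ * (sys.RD i).gain y) fun i => by
    unfold Link.gain; fun_prop
  have hind : IndepFun (∑ i ∈ S.erase m, g i) (g m) μ :=
    hgi.indepFun_finsetSum_of_notMem₀ hgm (Finset.notMem_erase m S)
  have hsm : AEMeasurable (∑ i ∈ S.erase m, g i) μ := Finset.aemeasurable_sum _ fun i _ => hgm i
  have hset : {ω | sys.weightedGain S (fun m => h m ω) = c} =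
      (fun ω => ((∑ i ∈ S.erase m, g i) ω, g m ω)) ⁻¹' {p : ℝ × ℝ | p.1 + p.2 = c} := by
    ext ω
    simp only [weightedGain, Set.mem_ofPred_eq, Set.mem_preimage, Finset.sum_apply]
    rw [← Finset.sum_erase_add S _ hm]
  have hms : MeasurableSet {p : ℝ × ℝ | p.1 + p.2 = c} :=
    measurableSet_eq_fun (by fun_prop) measurable_const
  rw [hset, ← Measure.map_apply_of_aemeasurable (hsm.prodMk (hgm m)) hms,
    (indepFun_iff_map_prod_eq_prod_map_map hsm (hgm m)).1 hind, Measure.measure_prod_null hms]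
  refine Eventually.of_forall fun z => ?_
  have h1 := (sys.RD m).pathLoss_pos; have h2 := (sys.RD m).ρ_pos
  have hpre : Prod.mk z ⁻¹' {p : ℝ × ℝ | p.1 + p.2 = c} = {c - z} := by
    ext y; simp [eq_sub_iff_add_eq, add_comm]
  change Measure.map (g m) μ (Prod.mk z ⁻¹' _) = 0
  rw [hpre, Measure.map_apply_of_aemeasurable (hgm m) (measurableSet_singleton _)]
  have hpre2 : g m ⁻¹' {c - z} = {ω | h m ω = (c - z) / ((sys.RD m).ρ * (sys.RD m).pathLoss)} := by
    ext ω
    simp only [hg, Link.gain, Set.mem_preimage, Set.mem_singleton_iff, Set.mem_ofPred_eq]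
    rw [eq_div_iff (by positivity)]
    ring_nf
  rw [hpre2, (law m).measure_eq (p := fun y => y = _) (measurableSet_singleton _)]
  exact gammaGamma_singleton _ _ _

theorem sumMGF_neg_eq_integral [IsProbabilityMeasure μ] {h : Fin N → Ω → ℝ}
    (law : ∀ m, HasLaw (h m) (gammaGamma (sys.RD m).α (sys.RD m).β) μ) (indep : iIndepFun h μ)
    (S : Finset (Fin N)) (s : ℂ) :
    sys.sumMGF S (-s) =
      ∫ u : ℝ, Complex.exp (-s * u) ∂(μ.map fun ω => sys.weightedGain S fun m => h m ω) := by
  rw [integral_map (sys.aemeasurable_weightedGain (fun m => (law m).aemeasurable) S)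
    (Continuous.aestronglyMeasurable (by fun_prop))]
  set f : Fin N → ℝ → ℂ := fun m y => Complex.exp ((sys.RD m).ρ * -s * (sys.RD m).gain y) with hf
  have hfc : ∀ m, Continuous (f m) := by
    intro m
    simp only [hf, Link.gain]
    fun_prop
  -- Independence factors the expectation of the exponential of the sum, after restricting the
  -- family to the links in `S`.
  have hprod := (indep.precomp (g := ((↑) : S → Fin N)) Subtype.val_injective).integral_prod_comp
    (f := fun m : S => f m) (fun m => (law m).aemeasurable)
    fun m => (hfc m).aestronglyMeasurable
  have hleft : ∀ ω, (∏ i : S, f i ∘ h i) ω =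
      Complex.exp (-s * (sys.weightedGain S fun m => h m ω : ℝ)) := by
    intro ω
    rw [Finset.prod_apply, Finset.prod_coe_sort S fun i => (f i ∘ h i) ω]
    simp only [hf, Function.comp_apply]
    rw [← Complex.exp_sum, weightedGain, Complex.ofReal_sum, Finset.mul_sum]
    congr 1
    refine Finset.sum_congr rfl fun m _ => ?_
    push_cast; ring
  simp only [hleft] at hprod
  rw [hprod, sumMGF, Finset.prod_coe_sort S fun i => ∫ ω, (f i ∘ h i) ω ∂μ]
  refine Finset.prod_congr rfl fun m _ => ?_
  rw [(law m).integral_comp (hfc m).aestronglyMeasurable, Link.mgf, complexMGF]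

end Probability

end RelaySystem
end FSO

/-! ### Total probability over the decoding set, and the outage probability. -/

namespace FSO
namespace RelaySystem

variable {N : ℕ} (sys : RelaySystem N) {Ω : Type*} [MeasurableSpace Ω] {μ : Measure Ω}

theorem indepFun_of_iIndepFun_sumElim {f g : Fin N → Ω → ℝ} (hf : ∀ m, AEMeasurable (f m) μ)
    (hg : ∀ m, AEMeasurable (g m) μ) (indep : iIndepFun (Sum.elim f g) μ) :
    IndepFun (fun ω m => f m ω) (fun ω m => g m ω) μ := by
  classical
  set I : Finset (Fin N ⊕ Fin N) := Finset.univ.map ⟨Sum.inl, Sum.inl_injective⟩ with hI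
  set J : Finset (Fin N ⊕ Fin N) := Finset.univ.map ⟨Sum.inr, Sum.inr_injective⟩ with hJ
  have h := indep.indepFun_finset₀ I J (by simp [hI, hJ, Finset.disjoint_left])
    (by rintro (m | m); exacts [hf m, hg m])
  have hI' : ∀ m, Sum.inl m ∈ I := by simp [hI]
  have hJ' : ∀ m, Sum.inr m ∈ J := by simp [hJ]
  exact h.comp (φ := fun (v : I → ℝ) (m : Fin N) => v ⟨Sum.inl m, hI' m⟩)
    (ψ := fun (v : J → ℝ) (m : Fin N) => v ⟨Sum.inr m, hJ' m⟩) (by fun_prop) (by fun_prop)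

variable [IsProbabilityMeasure μ]

theorem cdf_weightedGain_eq {h : Fin N → Ω → ℝ} (hm : ∀ m, AEMeasurable (h m) μ)
    (S : Finset (Fin N)) (x : ℝ) :
    cdf (μ.map fun ω => sys.weightedGain S fun m => h m ω) x =
      (μ.map fun ω => sys.weightedGain S fun m => h m ω).real (Set.Iic x) := by
  have := Measure.isProbabilityMeasure_map (sys.aemeasurable_weightedGain hm S)
  exact cdf_eq_real _ _

/-- Outage is a strict inequality and the cdf a weak one; they agree because the positive threshold
is not an atom. -/
theorem cdf_weightedGain_threshold {h : Fin N → Ω → ℝ}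
    (law : ∀ m, HasLaw (h m) (gammaGamma (sys.RD m).α (sys.RD m).β) μ) (indep : iIndepFun h μ)
    (S : Finset (Fin N)) :
    cdf (μ.map fun ω => sys.weightedGain S fun m => h m ω) (1 / sys.powerMargin) =
      μ.real {ω | sys.snr (sys.weightedGain S fun m => h m ω) < sys.γth} := by
  have hm : ∀ m, AEMeasurable (h m) μ := fun m => (law m).aemeasurable
  have hP := sys.powerMargin_pos
  rw [sys.cdf_weightedGain_eq hm, map_measureReal_apply_of_aemeasurable
    (sys.aemeasurable_weightedGain hm S) measurableSet_Iic]
  refine measureReal_congr ?_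
  have hpos : ∀ᵐ ω ∂μ, ∀ m, 0 < h m ω := by
    rw [ae_all_iff]
    exact fun m => ((law m).ae_iff (p := fun y => 0 < y) (by fun_prop)).2 (gammaGamma_ae_pos _ _)
  have hne : ∀ᵐ ω ∂μ, sys.weightedGain S (fun m => h m ω) ≠ 1 / sys.powerMargin := by
    rw [ae_iff]
    simpa using sys.measure_weightedGain_eq law indep S (c := 1 / sys.powerMargin) (by positivity)
  filter_upwards [hpos, hne] with ω hω hω'
  refine propext ?_
  change sys.weightedGain S (fun m => h m ω) ≤ 1 / sys.powerMargin ↔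
    sys.snr (sys.weightedGain S fun m => h m ω) < sys.γth
  rw [sys.snr_lt_iff (sys.weightedGain_nonneg S hω)]
  exact ⟨fun h1 => lt_of_le_of_ne h1 hω', le_of_lt⟩

theorem sum_measureReal_decodingSet_inter {h : Fin N → Ω → ℝ} (hm : ∀ m, AEMeasurable (h m) μ)
    {E : Set Ω} (hE : NullMeasurableSet E μ) :
    μ.real E = ∑ S : Finset (Fin N), μ.real ({ω | sys.decodingSet (fun m => h m ω) = S} ∩ E) := by
  have hcover : E = ⋃ S ∈ (Finset.univ : Finset (Finset (Fin N))),
      {ω | sys.decodingSet (fun m => h m ω) = S} ∩ E := by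
    ext ω; simp
  conv_lhs => rw [hcover]
  rw [measureReal_biUnion_finset₀]
  · intro S _ T _ hST
    refine Disjoint.aedisjoint ?_
    rw [Set.disjoint_left]
    rintro ω ⟨h1, _⟩ ⟨h2, _⟩
    exact hST (h1.symm.trans h2)
  · intro S _
    exact ((aemeasurable_pi_lambda _ hm).nullMeasurable (sys.measurableSet_decodingSet_eq S)).inter hE

theorem measureReal_outage {f g : Fin N → Ω → ℝ} (hf : ∀ m, AEMeasurable (f m) μ)
    (hg : ∀ m, AEMeasurable (g m) μ) (indep : iIndepFun (Sum.elim f g) μ) :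
    μ.real {ω | sys.Outage (fun m => f m ω) (fun m => g m ω)} =
      ∑ S : Finset (Fin N), μ.real {ω | sys.decodingSet (fun m => f m ω) = S} *
        μ.real {ω | sys.snr (sys.weightedGain S fun m => g m ω) < sys.γth} := by
  have hind := indepFun_of_iIndepFun_sumElim hf hg indep
  have hfm := aemeasurable_pi_lambda (fun ω m => f m ω) hf
  have hgm := aemeasurable_pi_lambda (fun ω m => g m ω) hg
  have hms : ∀ S, MeasurableSet {y : Fin N → ℝ | sys.snr (sys.weightedGain S y) < sys.γth} :=
    fun S => measurableSet_lt (sys.measurable_snr.comp (sys.measurable_weightedGain S))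
      measurable_const
  have hinter : ∀ S, {ω | sys.decodingSet (fun m => f m ω) = S} ∩
        {ω | sys.Outage (fun m => f m ω) (fun m => g m ω)} =
      {ω | sys.decodingSet (fun m => f m ω) = S} ∩
        {ω | sys.snr (sys.weightedGain S fun m => g m ω) < sys.γth} := by
    intro S
    ext ω
    simp only [Set.mem_inter_iff, Set.mem_ofPred_eq, sys.outage_iff]
    refine and_congr_right fun h => ?_
    rw [h]
  have hE : NullMeasurableSet {ω | sys.Outage (fun m => f m ω) (fun m => g m ω)} μ := by
    have : {ω | sys.Outage (fun m => f m ω) (fun m => g m ω)} =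
        ⋃ S, {ω | sys.decodingSet (fun m => f m ω) = S} ∩
          {ω | sys.snr (sys.weightedGain S fun m => g m ω) < sys.γth} := by
      simp only [← hinter]
      ext ω; simp
    rw [this]
    exact NullMeasurableSet.iUnion fun S =>
      (hfm.nullMeasurable (sys.measurableSet_decodingSet_eq S)).inter (hgm.nullMeasurable (hms S))
  rw [sys.sum_measureReal_decodingSet_inter hf hE]
  refine Finset.sum_congr rfl fun S _ => ?_
  rw [hinter]
  have := hind.measure_inter_preimage_eq_mul _ _ (sys.measurableSet_decodingSet_eq S) (hms S)
  simp only [measureReal_def]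
  rw [← ENNReal.toReal_mul]
  exact congrArg _ this

theorem sum_measureReal_decodingSet {h : Fin N → Ω → ℝ} (hm : ∀ m, AEMeasurable (h m) μ) :
    ∑ S : Finset (Fin N), μ.real {ω | sys.decodingSet (fun m => h m ω) = S} = 1 := by
  have := sys.sum_measureReal_decodingSet_inter hm (E := Set.univ) nullMeasurableSet_univ (μ := μ)
  simpa using this.symm

theorem exists_tendsto_eulerInversion_sumMGF {h : Fin N → Ω → ℝ}
    (law : ∀ m, HasLaw (h m) (gammaGamma (sys.RD m).α (sys.RD m).β) μ) (indep : iIndepFun h μ)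
    (S : Finset (Fin N)) {x A : ℝ} (hx : 0 < x) (hA : 0 < A) :
    ∃ ℓ : ℝ, Tendsto (fun p : ℕ × ℕ => eulerInversion (sys.sumMGF S) A p.1 p.2 x) cofinite (𝓝 ℓ) ∧
      0 ≤ ℓ - cdf (μ.map fun ω => sys.weightedGain S fun m => h m ω) x ∧
      ℓ - cdf (μ.map fun ω => sys.weightedGain S fun m => h m ω) x ≤
        Real.exp (-A) / (1 - Real.exp (-A)) := by
  have hm : ∀ m, AEMeasurable (h m) μ := fun m => (law m).aemeasurable
  have hw := sys.aemeasurable_weightedGain hm S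
  have := Measure.isProbabilityMeasure_map hw
  rw [sys.cdf_weightedGain_eq hm]
  refine exists_tendsto_eulerInversion ?_ (fun c hc => ?_)
    (fun s _ => sys.sumMGF_neg_eq_integral law indep S s) hx hA
  · rw [ae_map_iff hw measurableSet_Ici]
    have hpos : ∀ᵐ ω ∂μ, ∀ m, 0 < h m ω := by
      rw [ae_all_iff]
      exact fun m => ((law m).ae_iff (p := fun y => 0 < y) (by fun_prop)).2 (gammaGamma_ae_pos _ _)
    filter_upwards [hpos] with ω hω
    exact sys.weightedGain_nonneg S hω
  · rw [Measure.map_apply_of_aemeasurable hw (measurableSet_singleton c)]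
    exact sys.measure_weightedGain_eq law indep S hc

end RelaySystem
end FSO

theorem theorem2 {N : ℕ} (sys : FSO.RelaySystem N)
    {Ω : Type*} [MeasurableSpace Ω] (μ : Measure Ω) [IsProbabilityMeasure μ]
    (hSR hRD : Fin N → Ω → ℝ)
    (lawSR : ∀ m, HasLaw (hSR m) (FSO.gammaGamma (sys.SR m).α (sys.SR m).β) μ)
    (lawRD : ∀ m, HasLaw (hRD m) (FSO.gammaGamma (sys.RD m).α (sys.RD m).β) μ)
    (indep : iIndepFun (Sum.elim hSR hRD) μ) :
    let Pout : ℝ := μ.real {ω | sys.Outage (fun m => hSR m ω) (fun m => hRD m ω)}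
    let F : Finset (Fin N) → ℝ → ℝ := fun S x =>
      cdf (μ.map fun ω => sys.weightedGain S (fun m => hRD m ω)) x
    -- the weights are the probabilities of the decoding sets
    (∀ S : Finset (Fin N),
      ((μ.real {ω | sys.decodingSet (fun m => hSR m ω) = S} : ℝ) : ℂ) = sys.decodingWeight S) ∧
    -- the outage probability, through the cdf `F S` of the weighted sum over `S`
    ((Pout : ℂ) = ∑ S : Finset (Fin N), sys.decodingWeight S * (F S (1 / sys.powerMargin) : ℂ)) ∧
    -- the inversion formula for the cdf: it converges for `K + L → ∞`, up to an error that is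
    -- at most `exp (-A) / (1 - exp (-A))`
    (∀ (S : Finset (Fin N)) (x A : ℝ), 0 < x → 0 < A → ∃ ℓ : ℝ,
      Tendsto (fun p : ℕ × ℕ => FSO.eulerInversion (sys.sumMGF S) A p.1 p.2 x) cofinite (𝓝 ℓ) ∧
      0 ≤ ℓ - F S x ∧ ℓ - F S x ≤ Real.exp (-A) / (1 - Real.exp (-A))) ∧
    -- the outage probability, through the inversion formula
    (∀ A : ℝ, 0 < A → ∃ ℓ : ℝ,
      Tendsto (fun p : ℕ × ℕ => ∑ S : Finset (Fin N), sys.decodingWeight S *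
        (FSO.eulerInversion (sys.sumMGF S) A p.1 p.2 (1 / sys.powerMargin) : ℂ))
        cofinite (𝓝 (ℓ : ℂ)) ∧
      0 ≤ ℓ - Pout ∧ ℓ - Pout ≤ Real.exp (-A) / (1 - Real.exp (-A))) := by
  intro Pout F
  have hSRm : ∀ m, AEMeasurable (hSR m) μ := fun m => (lawSR m).aemeasurable
  have hRDm : ∀ m, AEMeasurable (hRD m) μ := fun m => (lawRD m).aemeasurable
  have indepSR : iIndepFun hSR μ := indep.precomp (g := Sum.inl) Sum.inl_injective
  have indepRD : iIndepFun hRD μ := indep.precomp (g := Sum.inr) Sum.inr_injective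
  set w : Finset (Fin N) → ℝ := fun S => μ.real {ω | sys.decodingSet (fun m => hSR m ω) = S} with hw
  have hweight : ∀ S, (w S : ℂ) = sys.decodingWeight S :=
    sys.measureReal_decodingSet_eq lawSR indepSR
  have hw1 : ∑ S, w S = 1 := sys.sum_measureReal_decodingSet hSRm
  have hPout : Pout = ∑ S, w S * F S (1 / sys.powerMargin) := by
    simp only [Pout, F, sys.measureReal_outage hSRm hRDm indep,
      sys.cdf_weightedGain_threshold lawRD indepRD, hw]
  have hinv : ∀ (S : Finset (Fin N)) (x A : ℝ), 0 < x → 0 < A → ∃ ℓ : ℝ,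
      Tendsto (fun p : ℕ × ℕ => FSO.eulerInversion (sys.sumMGF S) A p.1 p.2 x) cofinite (𝓝 ℓ) ∧
      0 ≤ ℓ - F S x ∧ ℓ - F S x ≤ Real.exp (-A) / (1 - Real.exp (-A)) :=
    fun S x A hx hA => sys.exists_tendsto_eulerInversion_sumMGF lawRD indepRD S hx hA
  refine ⟨hweight, ?_, hinv, fun A hA => ?_⟩
  · rw [hPout]
    push_cast
    simp only [hweight]
  · have hx : 0 < 1 / sys.powerMargin := one_div_pos.2 sys.powerMargin_pos
    choose ℓ hℓ hℓ0 hℓ1 using fun S => hinv S (1 / sys.powerMargin) A hx hA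
    -- The weights are nonnegative and sum to `1`, so bounds common to all `S` pass to the total
    -- error.
    have hdiff : ∑ S, w S * ℓ S - Pout = ∑ S, w S * (ℓ S - F S (1 / sys.powerMargin)) := by
      rw [hPout, ← Finset.sum_sub_distrib]
      simp only [mul_sub]
    refine ⟨∑ S, w S * ℓ S, ?_, ?_, ?_⟩
    · have h := tendsto_finsetSum Finset.univ fun S (_ : S ∈ Finset.univ) => (hℓ S).const_mul (w S)
      refine ((Complex.continuous_ofReal.tendsto _).comp h).congr fun p => ?_
      simp only [Function.comp_apply, Complex.ofReal_sum, Complex.ofReal_mul, hweight]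
    · rw [hdiff]
      exact Finset.sum_nonneg fun S _ => mul_nonneg measureReal_nonneg (hℓ0 S)
    · rw [hdiff]
      calc _ ≤ ∑ S, w S * (Real.exp (-A) / (1 - Real.exp (-A))) :=
            Finset.sum_le_sum fun S _ => mul_le_mul_of_nonneg_left (hℓ1 S) measureReal_nonneg
        _ = _ := by rw [← Finset.sum_mul, hw1, one_mul]
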